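/- Fix integers $d_g\ge 1$ and $d_v\ge 0$ (constants). In the $(d_g,d_v)$ knapsack problem we are given $n$ items; item $i$ is a $d_g$-dimensional cuboid with rational side lengths $\ell_1(i),\dots,\ell_{d_g}(i)\in[0,1]$, rational weights $v_1(i),\dots,v_{d_v}(i)\ge 0$ and a rational profit $p(i)\ge 0$. A packing of a set $S$ of items assigns to each $i\in S$ a position $x(i)\in\mathbb{R}^{d_g}$ such that each box $\prod_j[x_j(i),x_j(i)+\ell_j(i)]$ lies in $[0,1]^{d_g}$, the open boxes $\prod_j(x_j(i),x_j(i)+\ell_j(i))$ of distinct items of $S$ are disjoint, and $\sum_{i\in S}v_k(i)\le 1$ for every $k$. The goal is to output a set of items of maximum total profit that has a packing, together with such a packing (at rational positions). In $D$-dimensional vector knapsack the items have $D$ nonnegative rational weights and a nonnegative rational profit, and the goal is to output a set of maximum total profit whose total weight is at most $1$ in each coordinate. A $\rho$-approximation algorithm is an algorithm that runs in time polynomial in the bit length of the input and always outputs a feasible solution whose profit is at least $1/\rho$ times the optimum. For a $(d_g,d_v)$ instance $I$ let $\widehat I$ be the $(d_v+1)$-dimensional vector knapsack instance with the same items and profits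 in which the side lengths of item $i$ are replaced by the single weight $\mathrm{vol}(i)=\prod_j\ell_j(i)$. Let $b=1$ if $d_g=1$, $b=3$ if $d_g=2$, $b=9$ if $d_g=3$, and $b=4^{d_g}+2^{d_g}$ if $d_g\ge 4$. (1) Let $\alpha\ge 1$ and let $\mathcal A$ be an $\alpha$-approximation algorithm for $(d_v+1)$-dimensional vector knapsack. Then there is an algorithm $\mathcal B$ for $(d_g,d_v)$ knapsack such that, on every instance $I$, the set $\mathcal A(\widehat I)$ can be partitioned into $b$ (possibly empty) sets each having a packing, and $\mathcal B(I)$ is a packing of a most profitable one of these sets; and $\mathcal B$ is a $b\alpha$-approximation algorithm. In particular, for $d_g=2$, $\mathcal B$ is a $3\alpha$-approximation algorithm. (2) For every $\varepsilon>0$ there are a $(1+\varepsilon)$-approximation algorithm $\mathcal A$ for $(d_v+1)$-dimensional vector knapsack and an algorithm $\mathcal B$, related to $\mathcal A$ as in (1), that is a $b(1+\varepsilon)$-approximation algorithm for $(d_g,d_v)$ knapsack. In particular, there is a $3(1+\varepsilon)$-approximation algorithm for $(2,d_v)$ knapsack. -/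

import Mathlib

/-! ### Machine model

Programs manipulate finite binary trees whose leaves are rational numbers.  The running time is the
logarithmic (bit) cost: an elementary operation costs the total bit length of what it reads and
writes, so that polynomial time here is ordinary (Turing-machine) polynomial time. -/

/-- Data: trees with rational leaves.  `num 0` also serves as the empty list and as `false`. -/
inductive RVal : Type
  | num (q : ℚ) : RVal
  | pair (a b : RVal) : RVal

namespace RVal

/-- Bit length of a value. -/
def size : RVal → ℕ
  | num q => 1 + q.num.natAbs.size + q.den.size
  | pair a b => 1 + a.size + b.size

/-- A list of values as a value. -/
def ofList : List RVal → RVal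
  | [] => num 0
  | a :: l => pair a (ofList l)

/-- A vector of rationals as a value. -/
def ofVec {n : ℕ} (f : Fin n → ℚ) : RVal := ofList (List.ofFn fun i => num (f i))

/-- A binary arithmetic operation, acting on a pair of numbers (`num 0` on anything else). -/
def arith (op : ℚ → ℚ → ℚ) : RVal → RVal
  | pair (num a) (num b) => num (op a b)
  | _ => num 0

end RVal

/-- Elementary operations. -/
inductive RPrim : Type
  | id
  | const (v : RVal)
  | fst
  | snd
  | add
  | sub
  | mul
  | div
  | le
  | floor

/-- The effect of an elementary operation. -/
def RPrim.eval : RPrim → RVal → RVal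
  | id, v => v
  | const c, _ => c
  | fst, .pair a _ => a
  | fst, .num _ => .num 0
  | snd, .pair _ b => b
  | snd, .num _ => .num 0
  | add, v => v.arith (· + ·)
  | sub, v => v.arith (· - ·)
  | mul, v => v.arith (· * ·)
  | div, v => v.arith (· / ·)
  | le, v => v.arith fun a b => if a ≤ b then 1 else 0
  | floor, .num q => .num (⌊q⌋ : ℤ)
  | floor, .pair _ _ => .num 0

/-- Programs: sequential composition, running two programs on the same input and pairing the
results, branching, and unbounded while-loops. -/
inductive RCode : Type
  | prim (p : RPrim)
  | seq (f g : RCode)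
  | fork (f g : RCode)
  | cond (c f g : RCode)
  | loop (c f : RCode)

/-- `Runs f v w t`: the program `f`, started on `v`, halts with output `w` after time `t`. -/
inductive RCode.Runs : RCode → RVal → RVal → ℕ → Prop
  | prim (p : RPrim) (v : RVal) :
      Runs (.prim p) v (p.eval v) (1 + v.size + (p.eval v).size)
  | seq {f g : RCode} {v u w : RVal} {s t : ℕ} :
      Runs f v u s → Runs g u w t → Runs (.seq f g) v w (1 + s + t)
  | fork {f g : RCode} {v a b : RVal} {s t : ℕ} :
      Runs f v a s → Runs g v b t → Runs (.fork f g) v (.pair a b) (1 + s + t)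
  | condTrue {c f g : RCode} {v b w : RVal} {s t : ℕ} :
      Runs c v b s → b ≠ .num 0 → Runs f v w t → Runs (.cond c f g) v w (1 + s + t)
  | condFalse {c f g : RCode} {v w : RVal} {s t : ℕ} :
      Runs c v (.num 0) s → Runs g v w t → Runs (.cond c f g) v w (1 + s + t)
  | loopStop {c f : RCode} {v : RVal} {s : ℕ} :
      Runs c v (.num 0) s → Runs (.loop c f) v v (1 + s)
  | loopStep {c f : RCode} {v b u w : RVal} {r s t : ℕ} :
      Runs c v b r → b ≠ .num 0 → Runs f v u s → Runs (.loop c f) u w t →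
        Runs (.loop c f) v w (1 + r + s + t)

/-- `f`, started on `v`, halts with output `w`. -/
def RCode.Outputs (f : RCode) (v w : RVal) : Prop := ∃ t, f.Runs v w t

/-- In time polynomial in the bit length of the input, `f` halts on the encoding of every instance
`x`, with an output `w` that is correct for `x`. -/
def RCode.SolvesInPolyTime {X : Type} (f : RCode) (enc : X → RVal)
    (Correct : X → RVal → Prop) : Prop :=
  ∃ P : Polynomial ℕ, ∀ x : X, ∃ (w : RVal) (t : ℕ),
    f.Runs (enc x) w t ∧ t ≤ P.eval (enc x).size ∧ Correct x w

/-! ### Vector knapsack -/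

/-- An instance of `D`-dimensional vector knapsack. -/
structure VKSInstance (D : ℕ) where
  n : ℕ
  wt : Fin n → Fin D → ℚ
  profit : Fin n → ℚ
  wt_nonneg : ∀ i k, 0 ≤ wt i k
  profit_nonneg : ∀ i, 0 ≤ profit i

namespace VKSInstance

variable {D : ℕ} (I : VKSInstance D)

/-- The list of the items, each given by its profit and the list of its weights. -/
def encode : RVal :=
  .ofList (List.ofFn fun i => .pair (.num (I.profit i)) (.ofVec (I.wt i)))

/-- The items of `S` fit together into a bin with all capacities equal to 1. -/
def Feasible (S : Finset (Fin I.n)) : Prop := ∀ k, ∑ i ∈ S, I.wt i k ≤ 1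

end VKSInstance

/-- A selection of items, output as the list of their indices. -/
def encodeSelection {n : ℕ} (l : List (Fin n)) : RVal :=
  .ofList (l.map fun i : Fin n => .num ((i : ℕ) : ℚ))

/-- `f` is a polynomial-time `α`-approximation algorithm for `D`-dimensional vector knapsack. -/
def IsVKSApprox (D : ℕ) (α : ℝ) (f : RCode) : Prop :=
  f.SolvesInPolyTime (X := VKSInstance D) VKSInstance.encode fun I w =>
    ∃ l : List (Fin I.n), w = encodeSelection l ∧ l.Nodup ∧ I.Feasible l.toFinset ∧
      ∀ S : Finset (Fin I.n), I.Feasible S →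
        ((∑ i ∈ S, I.profit i : ℚ) : ℝ) ≤ α * ((∑ i ∈ l.toFinset, I.profit i : ℚ) : ℝ)

/-! ### Geometric-vector knapsack -/

/-- An instance of knapsack with `dg` geometric and `dv` vector dimensions: item `i` is a cuboid
with side lengths `len i j`, weights `wt i k` and a profit. -/
structure GVKSInstance (dg dv : ℕ) where
  n : ℕ
  len : Fin n → Fin dg → ℚ
  wt : Fin n → Fin dv → ℚ
  profit : Fin n → ℚ
  len_nonneg : ∀ i j, 0 ≤ len i j
  len_le_one : ∀ i j, len i j ≤ 1
  wt_nonneg : ∀ i k, 0 ≤ wt i k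
  profit_nonneg : ∀ i, 0 ≤ profit i

namespace GVKSInstance

variable {dg dv : ℕ} (I : GVKSInstance dg dv)

/-- The list of the items, each given by its profit, its side lengths and its weights. -/
def encode : RVal :=
  .ofList (List.ofFn fun i =>
    .pair (.num (I.profit i)) (.pair (.ofVec (I.len i)) (.ofVec (I.wt i))))

/-- The interior of the region occupied by item `i` when placed at position `x i`. -/
def openBox (x : Fin I.n → Fin dg → ℝ) (i : Fin I.n) : Set (Fin dg → ℝ) :=
  Set.pi Set.univ fun j => Set.Ioo (x i j) (x i j + (I.len i j : ℝ))

/-- Placing every item `i ∈ S` at `x i` is a valid packing of `S` into one unit bin. -/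
def IsPacking (S : Finset (Fin I.n)) (x : Fin I.n → Fin dg → ℝ) : Prop :=
  (∀ i ∈ S, ∀ j, 0 ≤ x i j ∧ x i j + (I.len i j : ℝ) ≤ 1) ∧
  (∀ i ∈ S, ∀ i' ∈ S, i ≠ i' → Disjoint (I.openBox x i) (I.openBox x i')) ∧
  ∀ k, ∑ i ∈ S, I.wt i k ≤ 1

/-- `S` can be packed into one bin. -/
def Packable (S : Finset (Fin I.n)) : Prop := ∃ x, I.IsPacking S x

/-- Total profit. -/
def totalProfit (S : Finset (Fin I.n)) : ℚ := ∑ i ∈ S, I.profit i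

/-- The vector knapsack instance in which the side lengths of each item are replaced by a single
weight, its volume (placed in coordinate `0`). -/
def toVKS : VKSInstance (dv + 1) where
  n := I.n
  wt i := Fin.cons (∏ j, I.len i j) (I.wt i)
  profit := I.profit
  wt_nonneg i k := by
    refine Fin.cases ?_ (fun k => ?_) k
    · simpa using Finset.prod_nonneg fun j _ => I.len_nonneg i j
    · simpa using I.wt_nonneg i k
  profit_nonneg := I.profit_nonneg

end GVKSInstance

/-- A packing, output as the list of the packed items with their (rational) positions. -/
def encodePacking {n dg : ℕ} (l : List (Fin n)) (x : Fin n → Fin dg → ℚ) : RVal :=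
  .ofList (l.map fun i : Fin n => .pair (.num ((i : ℕ) : ℚ)) (.ofVec (x i)))

/-- `f` is a polynomial-time `ρ`-approximation algorithm for knapsack with `dg` geometric and `dv`
vector dimensions; the optimum ranges over packings at arbitrary real positions. -/
def IsGVKSApprox (dg dv : ℕ) (ρ : ℝ) (f : RCode) : Prop :=
  f.SolvesInPolyTime (X := GVKSInstance dg dv) GVKSInstance.encode fun I w =>
    ∃ (l : List (Fin I.n)) (x : Fin I.n → Fin dg → ℚ),
      w = encodePacking l x ∧ l.Nodup ∧ I.IsPacking l.toFinset (fun i j => (x i j : ℝ)) ∧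
      ∀ S : Finset (Fin I.n), I.Packable S →
        (I.totalProfit S : ℝ) ≤ ρ * (I.totalProfit l.toFinset : ℝ)

/-- The number `b` of bins into which cuboids of total volume at most 1 are split. -/
def binCount : ℕ → ℕ
  | 1 => 1
  | 2 => 3
  | 3 => 9
  | d => 4 ^ d + 2 ^ d

/-- On every instance `I`, the items selected by the vector knapsack program `A` on `I.toVKS` split
into `binCount dg` bins, and the program `B` outputs the most profitable one of these bins. -/
def OutputsBestBin (dg dv : ℕ) (A B : RCode) : Prop :=
  ∀ I : GVKSInstance dg dv,
    ∃ (J : List (Fin I.n)) (bins : Fin (binCount dg) → Finset (Fin I.n)) (k : Fin (binCount dg))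
      (l : List (Fin I.n)) (x : Fin I.n → Fin dg → ℚ),
      A.Outputs I.toVKS.encode (encodeSelection J) ∧
      Finset.univ.biUnion bins = J.toFinset ∧
      (∀ a a', a ≠ a' → Disjoint (bins a) (bins a')) ∧
      (∀ a, I.Packable (bins a)) ∧
      (∀ a, I.totalProfit (bins a) ≤ I.totalProfit (bins k)) ∧
      l.toFinset = bins k ∧
      B.Outputs I.encode (encodePacking l x)

/-! ### Encodings and polynomial bounds -/

/-! The reduction compares the two optima. A packable set consists of disjoint boxes inside the unit
cube, so its volume is at most 1 (`GVKSInstance.sum_volume_le_one`), and it is feasible for the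
vector instance. Hence the vector optimum is at least the geometric one. Conversely, any set
feasible for the vector instance splits into `3 ^ (dg - 1)` packable bins. The best bin carries at
least that fraction of the profit, which gives the ratio `b * α`, because `3 ^ (dg - 1) ≤ b`
(`three_pow_le_binCount`).

The splitting (`packBoxes_spec`) goes by induction on the dimension. Call side 0 of a box its height
and the product of the other sides its width. Boxes are put on shelves greedily by decreasing
height, a new shelf being opened when the total width would exceed 1. A box that opens a shelf did
not fit on the previous one, whose boxes are at least as tall, so the height of the new shelf is at
most the volume on these two shelves (`shelves_spec`). The first shelf is stacked alone. The
remaining shelves, taken alternately, form two stacks; in each, the pairs of shelves that bound the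
heights are disjoint, so the stack has height at most 1 (`alternate_sum_le`). Each shelf has total
width at most 1, which is the induction hypothesis in one dimension less. So every additional
dimension costs a factor 3.

The approximation scheme for `D` weights compares with an optimal set `S`. In each dimension take
its `m` heaviest items and discard the least profitable of them; this loses at most `D / m` of the
profit (`exists_guess`). The other heavy items are guessed. The remaining items are chosen by
dynamic programming on weights rounded down to multiples of `μ / N`, where `μ` is the weight of the
discarded item and `N` the number of items. The total rounding error is at most `μ`, so it fits into
the room left by the discarded item (`VKSInstance.exists_candidate`, `exists_isVKSApprox`).

Polynomial running time is obtained compositionally: `PolyTime` is closed under composition,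
pairing, branching and folds over lists with a bounded accumulator (`PolyTime.foldl`), and all
algorithms are written as such folds. `exists_bestBin_program` then joins the given program to the
packing algorithm. -/

/-- A type whose elements are represented by values. -/
class Enc (α : Type) where
  /-- The value representing an element. -/
  enc : α → RVal

open Enc

instance Enc.rat : Enc ℚ := ⟨RVal.num⟩
instance Enc.nat : Enc ℕ := ⟨fun n => .num (n : ℚ)⟩
instance Enc.bool : Enc Bool := ⟨fun b => .num (if b then 1 else 0)⟩
instance Enc.prod {α β : Type} [Enc α] [Enc β] : Enc (α × β) := ⟨fun p => .pair (enc p.1) (enc p.2)⟩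
instance Enc.list {α : Type} [Enc α] : Enc (List α) := ⟨fun l => .ofList (l.map enc)⟩
instance Enc.vec {α : Type} [Enc α] {n : ℕ} : Enc (Fin n → α) :=
  ⟨fun f => .ofList (List.ofFn fun i => enc (f i))⟩

/-- The bit length of the representation. -/
def sz {α : Type} [Enc α] (a : α) : ℕ := (enc a).size

/-- `g a` is bounded by a polynomial in the bit length of `a`. -/
def PolyBdd {α : Type} [Enc α] (g : α → ℕ) : Prop := ∃ k : ℕ, ∀ a, g a ≤ (sz a + 2) ^ k

section PolyBdd

variable {α β : Type} [Enc α] [Enc β]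

theorem PolyBdd.mono {g h : α → ℕ} (hh : PolyBdd h) (hgh : ∀ a, g a ≤ h a) : PolyBdd g :=
  let ⟨k, hk⟩ := hh
  ⟨k, fun a => (hgh a).trans (hk a)⟩

theorem PolyBdd.const (c : ℕ) : PolyBdd fun _ : α => c :=
  ⟨c, fun a => (Nat.lt_two_pow_self).le.trans (Nat.pow_le_pow_left (by omega) c)⟩

theorem PolyBdd.sz : PolyBdd fun a : α => sz a := ⟨1, fun a => by simp⟩

theorem PolyBdd.add {g h : α → ℕ} (hg : PolyBdd g) (hh : PolyBdd h) :
    PolyBdd fun a => g a + h a := by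
  obtain ⟨k, hk⟩ := hg
  obtain ⟨j, hj⟩ := hh
  -- The sum is at most twice the larger power, and the base, being at least 2, absorbs this factor.
  refine ⟨max k j + 1, fun a => ?_⟩
  have h1 : g a ≤ (_root_.sz a + 2) ^ max k j :=
    (hk a).trans (Nat.pow_le_pow_right (by omega) (le_max_left _ _))
  have h2 : h a ≤ (_root_.sz a + 2) ^ max k j :=
    (hj a).trans (Nat.pow_le_pow_right (by omega) (le_max_right _ _))
  rw [pow_succ]
  nlinarith [Nat.zero_le (_root_.sz a), Nat.zero_le ((_root_.sz a + 2) ^ max k j)]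

theorem PolyBdd.mul {g h : α → ℕ} (hg : PolyBdd g) (hh : PolyBdd h) :
    PolyBdd fun a => g a * h a := by
  obtain ⟨k, hk⟩ := hg
  obtain ⟨j, hj⟩ := hh
  exact ⟨k + j, fun a => by rw [pow_add]; exact Nat.mul_le_mul (hk a) (hj a)⟩

theorem PolyBdd.pow {g : α → ℕ} (hg : PolyBdd g) (n : ℕ) : PolyBdd fun a => g a ^ n := by
  obtain ⟨k, hk⟩ := hg
  exact ⟨k * n, fun a => by rw [pow_mul]; exact Nat.pow_le_pow_left (hk a) n⟩

/-- A polynomial bound in terms of a polynomially bounded quantity. -/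
theorem PolyBdd.pow_of_le {g h : α → ℕ} (hh : PolyBdd h) (k : ℕ)
    (hgh : ∀ a, g a ≤ (h a + 2) ^ k) : PolyBdd g :=
  ((hh.add (.const 2)).pow k).mono hgh

theorem PolyBdd.comp {g : β → ℕ} (hg : PolyBdd g) {f : α → β}
    (hf : PolyBdd fun a => _root_.sz (f a)) :
    PolyBdd fun a => g (f a) :=
  let ⟨k, hk⟩ := hg
  hf.pow_of_le k fun a => hk (f a)

/-- Translates the polynomials of `SolvesInPolyTime` into the powers used by `PolyBdd`. A
coefficient `c` is absorbed through `c ≤ 2 ^ c`. -/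
theorem Polynomial.exists_eval_le_pow (p : Polynomial ℕ) :
    ∃ k : ℕ, ∀ s t : ℕ, s ≤ t → p.eval s ≤ (t + 2) ^ k := by
  induction p using Polynomial.induction_on' with
  | add p q hp hq =>
    obtain ⟨k, hk⟩ := hp
    obtain ⟨j, hj⟩ := hq
    refine ⟨max k j + 1, fun s t h => ?_⟩
    have h1 : p.eval s ≤ (t + 2) ^ max k j :=
      (hk s t h).trans (Nat.pow_le_pow_right (by omega) (le_max_left _ _))
    have h2 : q.eval s ≤ (t + 2) ^ max k j :=
      (hj s t h).trans (Nat.pow_le_pow_right (by omega) (le_max_right _ _))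
    rw [pow_succ, Polynomial.eval_add]
    nlinarith [Nat.zero_le t, Nat.zero_le ((t + 2) ^ max k j)]
  | monomial n c =>
    refine ⟨c + n, fun s t h => ?_⟩
    rw [Polynomial.eval_monomial, pow_add]
    exact Nat.mul_le_mul ((Nat.lt_two_pow_self).le.trans (Nat.pow_le_pow_left (by omega) c))
      (Nat.pow_le_pow_left (by omega) n)

end PolyBdd

/-! ### Polynomial-time functions -/

/-- `f` is computed by a program in time polynomial in the bit length of the argument. -/
def PolyTime {α β : Type} [Enc α] [Enc β] (f : α → β) : Prop :=
  ∃ (c : RCode) (T : α → ℕ), PolyBdd T ∧ ∀ a, ∃ t, t ≤ T a ∧ c.Runs (enc a) (enc (f a)) t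

/-- Elementary operations are charged for everything they read and write. Time bounds therefore
bound output sizes, which is what makes polynomial time closed under composition. -/
theorem RCode.Runs.size_le {c : RCode} {v w : RVal} {t : ℕ} (h : c.Runs v w t) :
    v.size ≤ t ∧ w.size ≤ t := by
  induction h with
  | prim p v => omega
  | seq _ _ h1 h2 => omega
  | fork _ _ h1 h2 => simp only [RVal.size]; omega
  | condTrue _ _ _ h1 h2 => omega
  | condFalse _ _ h1 h2 => omega
  | loopStop _ h1 => omega
  | loopStep _ _ _ _ h1 h2 h3 => omega

theorem RVal.one_le_size (v : RVal) : 1 ≤ v.size := by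
  cases v <;> simp only [RVal.size] <;> omega

section PolyTime

variable {α β γ σ : Type} [Enc α] [Enc β] [Enc γ] [Enc σ]

@[simp] theorem enc_pair (a : α) (b : β) : enc (a, b) = .pair (enc a) (enc b) := rfl
@[simp] theorem enc_nil : enc ([] : List α) = .num 0 := rfl
@[simp] theorem enc_cons (a : α) (l : List α) : enc (a :: l) = .pair (enc a) (enc l) := rfl
@[simp] theorem sz_pair (a : α) (b : β) : sz (a, b) = 1 + sz a + sz b := rfl
@[simp] theorem sz_nil : sz ([] : List α) = 2 := by
  simp [sz, RVal.size]
@[simp] theorem sz_cons (a : α) (l : List α) : sz (a :: l) = 1 + sz a + sz l := rfl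

theorem one_le_sz (a : α) : 1 ≤ sz a := RVal.one_le_size _

theorem PolyTime.polyBdd {f : α → β} (hf : PolyTime f) : PolyBdd fun a => sz (f a) := by
  obtain ⟨c, T, hT, h⟩ := hf
  refine hT.mono fun a => ?_
  obtain ⟨t, ht, hr⟩ := h a
  exact hr.size_le.2.trans ht

theorem PolyTime.of_prim (p : RPrim) {f : α → β} (hp : ∀ a, p.eval (enc a) = enc (f a))
    (hb : PolyBdd fun a => sz (f a)) : PolyTime f :=
  ⟨.prim p, fun a => 1 + sz a + sz (f a), ((PolyBdd.const 1).add .sz).add hb, fun a =>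
    ⟨_, le_rfl, by have := RCode.Runs.prim p (enc a); rwa [hp] at this⟩⟩

/-- A change of type that leaves the representation alone is computed by the identity program. -/
theorem PolyTime.of_enc_eq {f : α → β} (h : ∀ a, enc (f a) = enc a) : PolyTime f :=
  .of_prim .id (fun a => (h a).symm) (PolyBdd.sz.mono fun a => by simp [sz, h])

theorem PolyTime.id : PolyTime fun a : α => a := .of_enc_eq fun _ => rfl

theorem PolyTime.const (b : β) : PolyTime fun _ : α => b :=
  .of_prim (.const (enc b)) (fun _ => rfl) (.const _)

theorem PolyTime.comp {f : β → γ} {g : α → β} (hf : PolyTime f) (hg : PolyTime g) :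
    PolyTime fun a => f (g a) := by
  have hb := hg.polyBdd
  obtain ⟨c, T, hT, h⟩ := hf
  obtain ⟨d, U, hU, k⟩ := hg
  refine ⟨.seq d c, fun a => 1 + U a + T (g a), ((PolyBdd.const 1).add hU).add (hT.comp hb),
    fun a => ?_⟩
  obtain ⟨s, hs, hr⟩ := k a
  obtain ⟨t, ht, hq⟩ := h (g a)
  exact ⟨_, by dsimp only; omega, hr.seq hq⟩

theorem PolyTime.pair {f : α → β} {g : α → γ} (hf : PolyTime f) (hg : PolyTime g) :
    PolyTime fun a => (f a, g a) := by
  obtain ⟨c, T, hT, h⟩ := hf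
  obtain ⟨d, U, hU, k⟩ := hg
  refine ⟨.fork c d, fun a => 1 + T a + U a, ((PolyBdd.const 1).add hT).add hU, fun a => ?_⟩
  obtain ⟨s, hs, hr⟩ := h a
  obtain ⟨t, ht, hq⟩ := k a
  exact ⟨_, by dsimp only; omega, hr.fork hq⟩

theorem PolyTime.fst' : PolyTime fun p : α × β => p.1 :=
  .of_prim .fst (fun _ => rfl) (PolyBdd.sz.mono fun p => by rw [sz_pair p.1 p.2]; omega)

theorem PolyTime.snd' : PolyTime fun p : α × β => p.2 :=
  .of_prim .snd (fun _ => rfl) (PolyBdd.sz.mono fun p => by rw [sz_pair p.1 p.2]; omega)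

theorem PolyTime.fst {f : α → β × γ} (hf : PolyTime f) : PolyTime fun a => (f a).1 :=
  fst'.comp hf

theorem PolyTime.snd {f : α → β × γ} (hf : PolyTime f) : PolyTime fun a => (f a).2 :=
  snd'.comp hf

theorem PolyTime.cons {f : α → β} {g : α → List β} (hf : PolyTime f) (hg : PolyTime g) :
    PolyTime fun a => f a :: g a :=
  (PolyTime.of_enc_eq (f := fun p : β × List β => p.1 :: p.2) fun _ => rfl).comp (hf.pair hg)

/-! ### Decidable conditions -/

/-- `p` is decided in polynomial time. -/
def PolyDec (p : α → Prop) : Prop := ∃ f : α → Bool, PolyTime f ∧ ∀ a, f a = true ↔ p a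

theorem PolyTime.ite {p : α → Prop} [DecidablePred p] {f g : α → β} (hp : PolyDec p)
    (hf : PolyTime f) (hg : PolyTime g) : PolyTime fun a => if p a then f a else g a := by
  obtain ⟨b, ⟨e, V, hV, m⟩, hb⟩ := hp
  obtain ⟨c, T, hT, h⟩ := hf
  obtain ⟨d, U, hU, k⟩ := hg
  refine ⟨.cond e c d, fun a => 1 + V a + (T a + U a), ((PolyBdd.const 1).add hV).add (hT.add hU),
    fun a => ?_⟩
  obtain ⟨r, hr, hv⟩ := m a
  obtain ⟨s, hs, hr'⟩ := h a
  obtain ⟨t, ht, hq⟩ := k a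
  by_cases hpa : p a
  · rw [(hb a).2 hpa] at hv
    simp only [hpa, if_true]
    exact ⟨1 + r + s, by omega, hv.condTrue (by simp [enc]) hr'⟩
  · rw [Bool.eq_false_iff.2 fun hba => hpa ((hb a).1 hba)] at hv
    simp only [hpa, if_false]
    exact ⟨1 + r + t, by omega, .condFalse (by simpa [enc] using hv) hq⟩

theorem PolyDec.of_iff {p q : α → Prop} (hp : PolyDec p) (h : ∀ a, q a ↔ p a) : PolyDec q :=
  let ⟨f, hf, hfp⟩ := hp
  ⟨f, hf, fun a => (hfp a).trans (h a).symm⟩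

theorem PolyDec.comp {p : β → Prop} {g : α → β} (hp : PolyDec p) (hg : PolyTime g) :
    PolyDec fun a => p (g a) :=
  let ⟨f, hf, hfp⟩ := hp
  ⟨fun a => f (g a), hf.comp hg, fun a => hfp (g a)⟩

theorem PolyDec.decide {p : α → Prop} [DecidablePred p] (hp : PolyDec p) :
    PolyTime fun a => Decidable.decide (p a) := by
  obtain ⟨f, hf, hfp⟩ := hp
  convert hf using 2 with a
  rw [Bool.eq_iff_iff, hfp, decide_eq_true_iff]

theorem PolyDec.const (q : Prop) : PolyDec fun _ : α => q := by
  classical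
  exact ⟨fun _ => Decidable.decide q, .const _, fun _ => by simp⟩

theorem PolyDec.and {p q : α → Prop} (hp : PolyDec p) (hq : PolyDec q) :
    PolyDec fun a => p a ∧ q a := by
  classical
  refine ⟨fun a => if p a then Decidable.decide (q a) else false, .ite hp hq.decide (.const _),
    fun a => ?_⟩
  by_cases h : p a <;> simp [h]

theorem PolyDec.not {p : α → Prop} (hp : PolyDec p) : PolyDec fun a => ¬ p a := by
  classical
  refine ⟨fun a => if p a then false else true, .ite hp (.const _) (.const _), fun a => ?_⟩
  by_cases h : p a <;> simp [h]

end PolyTime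

/-! ### Arithmetic -/

theorem Nat.size_mul_le (m n : ℕ) : (m * n).size ≤ m.size + n.size := by
  rw [Nat.size_le, pow_add]
  exact Nat.mul_lt_mul'' (Nat.lt_size_self m) (Nat.lt_size_self n)

/-- Twice the height of a rational number. -/
def Rat.height2 (q : ℚ) : ℕ := 2 * max q.num.natAbs q.den

/-- A bit length that is subadditive under addition and multiplication of rational numbers. -/
def Rat.bits (q : ℚ) : ℕ := q.height2.size

theorem Rat.natAbs_num_le (q : ℚ) : 2 * q.num.natAbs ≤ q.height2 :=
  Nat.mul_le_mul_left 2 (le_max_left _ _)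

theorem Rat.den_le (q : ℚ) : 2 * q.den ≤ q.height2 := Nat.mul_le_mul_left 2 (le_max_right _ _)

theorem sz_rat_le (q : ℚ) : sz q ≤ 2 * q.bits + 1 := by
  have h1 : q.num.natAbs.size ≤ q.bits := Nat.size_le_size (by have := q.natAbs_num_le; omega)
  have h2 : q.den.size ≤ q.bits := Nat.size_le_size (by have := q.den_le; omega)
  simp only [sz, enc, RVal.size]
  omega

theorem Rat.bits_le (q : ℚ) : q.bits ≤ sz q + 1 := by
  have h0 : (2 : ℕ).size = 2 := by decide
  have h1 : (max q.num.natAbs q.den).size ≤ q.num.natAbs.size + q.den.size := by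
    rcases max_cases q.num.natAbs q.den with h | h <;> rw [h.1] <;> omega
  have h2 := Nat.size_mul_le 2 (max q.num.natAbs q.den)
  simp only [Rat.bits, Rat.height2, sz, enc, RVal.size]
  omega

/-- Reduction to lowest terms only shrinks numerator and denominator, so any fraction representing
`q` may be used for the estimate. -/
theorem Rat.bits_le_of_divInt {q : ℚ} {n d : ℤ} (hq : q = n / d) (hd : d ≠ 0) {m : ℕ}
    (hn : 2 * n.natAbs ≤ m) (hdm : 2 * d.natAbs ≤ m) : q.bits ≤ m.size := by
  have hq' : q = Rat.divInt n d := by rw [hq, Rat.divInt_eq_div]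
  have h1 : q.num ∣ n := by rw [hq']; exact Rat.num_dvd n hd
  have h2 : (q.den : ℤ) ∣ d := by rw [hq']; exact Rat.den_dvd n d
  have h4 : q.den ≤ d.natAbs :=
    Nat.le_of_dvd (Int.natAbs_pos.2 hd) (Int.natCast_dvd.1 h2)
  have h3 : q.num.natAbs ≤ n.natAbs := by
    rcases eq_or_ne n 0 with rfl | hn0
    · simp [hq']
    · exact Nat.le_of_dvd (Int.natAbs_pos.2 hn0) (Int.natAbs_dvd_natAbs.2 h1)
  refine Nat.size_le_size ?_
  rw [Rat.height2]
  rcases max_cases q.num.natAbs q.den with h | h <;> omega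

/-- The numerator of a sum is at most twice the product of the two heights. The factor 2 in
`Rat.height2` absorbs this, so no additive constant appears. -/
theorem Rat.bits_add_le (a b : ℚ) : (a + b).bits ≤ a.bits + b.bits := by
  refine le_trans ?_ (Nat.size_mul_le a.height2 b.height2)
  have h1 := a.natAbs_num_le
  have h2 := a.den_le
  have h3 := b.natAbs_num_le
  have h4 := b.den_le
  have ha : (a.den : ℚ) ≠ 0 := by exact_mod_cast a.den_nz
  have hb : (b.den : ℚ) ≠ 0 := by exact_mod_cast b.den_nz
  refine Rat.bits_le_of_divInt (n := a.num * b.den + b.num * a.den) (d := a.den * b.den) ?_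
    (by exact_mod_cast mul_ne_zero a.den_nz b.den_nz) ?_ ?_
  · push_cast
    nth_rewrite 1 [← Rat.num_div_den a, ← Rat.num_div_den b]
    field_simp
  · have := Int.natAbs_add_le (a.num * b.den) (b.num * a.den)
    simp only [Int.natAbs_mul, Int.natAbs_natCast] at this
    nlinarith [Nat.mul_le_mul h1 h4, Nat.mul_le_mul h2 h3]
  · simp only [Int.natAbs_mul, Int.natAbs_natCast]
    nlinarith [Nat.mul_le_mul h2 h4]

theorem Rat.bits_mul_le (a b : ℚ) : (a * b).bits ≤ a.bits + b.bits := by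
  refine le_trans ?_ (Nat.size_mul_le a.height2 b.height2)
  have h1 := a.natAbs_num_le
  have h2 := a.den_le
  have h3 := b.natAbs_num_le
  have h4 := b.den_le
  have ha : (a.den : ℚ) ≠ 0 := by exact_mod_cast a.den_nz
  have hb : (b.den : ℚ) ≠ 0 := by exact_mod_cast b.den_nz
  refine Rat.bits_le_of_divInt (n := a.num * b.num) (d := a.den * b.den) ?_
    (by exact_mod_cast mul_ne_zero a.den_nz b.den_nz) ?_ ?_
  · push_cast
    nth_rewrite 1 [← Rat.num_div_den a, ← Rat.num_div_den b]
    field_simp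
  · simp only [Int.natAbs_mul]
    nlinarith [Nat.mul_le_mul h1 h3]
  · simp only [Int.natAbs_mul, Int.natAbs_natCast]
    nlinarith [Nat.mul_le_mul h2 h4]

theorem Rat.bits_inv_le (a : ℚ) : a⁻¹.bits ≤ a.bits := by
  rcases eq_or_ne a 0 with rfl | ha
  · simp
  · refine Rat.bits_le_of_divInt (n := a.den) (d := a.num) ?_ (Rat.num_ne_zero.2 ha) ?_
      a.natAbs_num_le
    · nth_rewrite 1 [← Rat.num_div_den a]
      simp
    · simpa using a.den_le

section Arithmetic

variable {α : Type} [Enc α] {f g : α → ℚ}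

theorem PolyBdd.bits (hf : PolyBdd fun a => _root_.sz (f a)) : PolyBdd fun a => (f a).bits :=
  (hf.add (.const 1)).mono fun a => (f a).bits_le

theorem PolyBdd.sz_of_bits (hf : PolyBdd fun a => (f a).bits) : PolyBdd fun a => _root_.sz (f a) :=
  (((PolyBdd.const 2).mul hf).add (.const 1)).mono fun a => sz_rat_le (f a)

theorem PolyTime.arith {op : ℚ → ℚ → ℚ} (p : RPrim) (hp : ∀ v, p.eval v = v.arith op)
    (hop : ∀ x y, (op x y).bits ≤ x.bits + y.bits) (hf : PolyTime f) (hg : PolyTime g) :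
    PolyTime fun a => op (f a) (g a) :=
  (PolyTime.of_prim (f := fun x : ℚ × ℚ => op x.1 x.2) p (fun _ => hp _)
    (PolyBdd.sz_of_bits (((PolyTime.fst'.polyBdd.bits).add
      (PolyTime.snd'.polyBdd.bits)).mono fun x => hop x.1 x.2))).comp (hf.pair hg)

theorem PolyTime.add (hf : PolyTime f) (hg : PolyTime g) : PolyTime fun a => f a + g a :=
  hf.arith .add (fun _ => rfl) Rat.bits_add_le hg

theorem PolyTime.mul (hf : PolyTime f) (hg : PolyTime g) : PolyTime fun a => f a * g a :=
  hf.arith .mul (fun _ => rfl) Rat.bits_mul_le hg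

theorem PolyTime.div (hf : PolyTime f) (hg : PolyTime g) : PolyTime fun a => f a / g a :=
  hf.arith .div (fun _ => rfl) (fun x y => by
    rw [div_eq_mul_inv]
    exact (Rat.bits_mul_le _ _).trans (Nat.add_le_add_left (Rat.bits_inv_le y) _)) hg

theorem PolyTime.floor (hf : PolyTime f) : PolyTime fun a => ((⌊f a⌋ : ℤ) : ℚ) :=
  (PolyTime.of_prim (f := fun x : ℚ => ((⌊x⌋ : ℤ) : ℚ)) .floor (fun _ => rfl)
    (PolyBdd.sz.mono fun x => by
      have h1 : (⌊x⌋ : ℤ).natAbs ≤ x.num.natAbs := by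
        rw [Rat.floor_def']
        exact Int.natAbs_ediv_le_natAbs _ _
      have h2 := Nat.size_le_size h1
      have h3 : (1 : ℕ).size ≤ x.den.size := Nat.size_le_size x.den_pos
      simp only [_root_.sz, enc, RVal.size, Rat.num_intCast, Rat.den_intCast]
      omega)).comp hf

theorem PolyDec.le (hf : PolyTime f) (hg : PolyTime g) : PolyDec fun a => f a ≤ g a :=
  PolyDec.comp (p := fun x : ℚ × ℚ => x.1 ≤ x.2)
    ⟨fun x => Decidable.decide (x.1 ≤ x.2), .of_prim .le (fun x => by
        simp [enc, RPrim.eval, RVal.arith])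
      ((PolyBdd.const 4).mono fun x => by
        by_cases h : x.1 ≤ x.2 <;> simp [h, _root_.sz, enc, RVal.size]), fun x => by simp⟩
    (hf.pair hg)

theorem PolyDec.lt (hf : PolyTime f) (hg : PolyTime g) : PolyDec fun a => f a < g a :=
  (PolyDec.le hg hf).not.of_iff fun _ => not_le.symm

theorem PolyDec.eq (hf : PolyTime f) (hg : PolyTime g) : PolyDec fun a => f a = g a :=
  ((PolyDec.le hf hg).and (PolyDec.le hg hf)).of_iff fun _ => le_antisymm_iff

end Arithmetic

section NatArithmetic

variable {α : Type} [Enc α] {f g : α → ℕ}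

theorem PolyTime.natCast (hf : PolyTime f) : PolyTime fun a => (f a : ℚ) :=
  (PolyTime.of_enc_eq (f := fun n : ℕ => (n : ℚ)) fun _ => rfl).comp hf

/-- True by definition, natural numbers being represented as rationals. -/
theorem PolyTime.of_natCast (hf : PolyTime fun a => (f a : ℚ)) : PolyTime f := hf

theorem PolyTime.nat_add (hf : PolyTime f) (hg : PolyTime g) : PolyTime fun a => f a + g a :=
  .of_natCast (by simpa using hf.natCast.add hg.natCast)

theorem PolyTime.nat_mul (hf : PolyTime f) (hg : PolyTime g) : PolyTime fun a => f a * g a :=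
  .of_natCast (by simpa using hf.natCast.mul hg.natCast)

theorem PolyDec.nat_eq (hf : PolyTime f) (hg : PolyTime g) : PolyDec fun a => f a = g a :=
  (PolyDec.eq hf.natCast hg.natCast).of_iff fun _ => Nat.cast_inj.symm

end NatArithmetic

/-! ### Vectors of fixed length -/

section Vectors

variable {α β : Type} [Enc α] [Enc β]

theorem enc_vec_succ {n : ℕ} (f : Fin (n + 1) → α) :
    enc f = .pair (enc (f 0)) (enc fun i : Fin n => f i.succ) := by
  simp only [enc, List.ofFn_succ, RVal.ofList]

/-- The length is a constant, so every coordinate may have a program of its own. -/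
theorem PolyTime.vec {n : ℕ} {f : α → Fin n → β} (hf : ∀ i, PolyTime fun a => f a i) :
    PolyTime f := by
  induction n with
  -- The empty vector and the empty list have the same representation.
  | zero => exact (PolyTime.const ([] : List β)).comp (PolyTime.id (α := α))
  | succ n ih =>
    obtain ⟨c, T, hT, h⟩ := (hf 0).pair (ih (f := fun a i => f a i.succ) fun i => hf i.succ)
    exact ⟨c, T, hT, fun a => by rw [enc_vec_succ]; exact h a⟩

theorem PolyTime.vec_tail {n : ℕ} {f : α → Fin (n + 1) → β} (hf : PolyTime f) :
    PolyTime fun a (i : Fin n) => f a i.succ :=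
  (PolyTime.of_prim (f := fun (v : Fin (n + 1) → β) (i : Fin n) => v i.succ) .snd
    (fun v => by rw [enc_vec_succ]; rfl) (PolyBdd.sz.mono fun v => by
      simp only [sz, enc_vec_succ v, RVal.size]; omega)).comp hf

theorem PolyTime.get {n : ℕ} {f : α → Fin n → β} (hf : PolyTime f) (i : Fin n) :
    PolyTime fun a => f a i := by
  induction n with
  | zero => exact i.elim0
  | succ n ih =>
    refine Fin.cases ?_ (fun i => ?_) i
    · exact (PolyTime.of_prim (f := fun v : Fin (n + 1) → β => v 0) .fst
        (fun v => by rw [enc_vec_succ]; rfl) (PolyBdd.sz.mono fun v => by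
          simp only [sz, enc_vec_succ v, RVal.size]; omega)).comp hf
    · exact ih hf.vec_tail i

theorem PolyDec.forall_fin {n : ℕ} {p : α → Fin n → Prop} (hp : ∀ i, PolyDec fun a => p a i) :
    PolyDec fun a => ∀ i, p a i := by
  induction n with
  | zero => exact (PolyDec.const True).of_iff fun a => by simp
  | succ n ih =>
    exact ((hp 0).and (ih (p := fun a i => p a i.succ) fun i => hp i.succ)).of_iff fun a =>
      Fin.forall_fin_succ

theorem PolyTime.prod_fin {n : ℕ} {f : α → Fin n → ℚ} (hf : ∀ i, PolyTime fun a => f a i) :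
    PolyTime fun a => ∏ i, f a i := by
  induction n with
  | zero => simpa using PolyTime.const (α := α) (1 : ℚ)
  | succ n ih =>
    simp only [Fin.prod_univ_succ]
    exact (hf 0).mul (ih (f := fun a i => f a i.succ) fun i => hf i.succ)

end Vectors

/-! ### Folding over lists -/

section Fold

variable {α β γ σ : Type} [Enc α] [Enc β] [Enc γ] [Enc σ]

theorem sz_le_of_mem {x : β} {l : List β} (h : x ∈ l) : sz x ≤ sz l := by
  induction l with
  | nil => simp at h
  | cons y l ih =>
    rw [sz_cons]
    rcases List.mem_cons.1 h with rfl | h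
    · omega
    · have := ih h
      omega

theorem List.Sublist.sz_le {l₁ l₂ : List β} (h : l₁.Sublist l₂) : sz l₁ ≤ sz l₂ := by
  induction h with
  | slnil => exact le_rfl
  | cons a _ ih => rw [sz_cons]; omega
  | cons_cons a _ ih => rw [sz_cons, sz_cons]; omega

theorem sz_append (l₁ l₂ : List β) : sz (l₁ ++ l₂) + 2 = sz l₁ + sz l₂ := by
  induction l₁ with
  | nil => simp; omega
  | cons a l ih => rw [List.cons_append, sz_cons, sz_cons]; omega

theorem List.Perm.sz_eq {l₁ l₂ : List β} (h : l₁.Perm l₂) : sz l₁ = sz l₂ := by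
  induction h with
  | nil => rfl
  | cons a _ ih => rw [sz_cons, sz_cons, ih]
  | swap a b l => simp only [sz_cons]; omega
  | trans _ _ ih₁ ih₂ => exact ih₁.trans ih₂

theorem length_le_sz (l : List β) : l.length ≤ sz l := by
  induction l with
  | nil => simp
  | cons a l ih => rw [sz_cons, List.length_cons]; omega

theorem sz_le_of_forall_mem {l : List β} {n : ℕ} (h : ∀ x ∈ l, sz x ≤ n) :
    sz l ≤ 2 + l.length * (1 + n) := by
  induction l with
  | nil => simp
  | cons a l ih =>
    have h1 := h a (by simp)
    have h2 := ih fun x hx => h x (by simp [hx])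
    rw [sz_cons, List.length_cons, add_mul]
    omega

/-- One while-loop runs on the triple (remaining list, parameter, accumulator). The remaining list
itself is the loop condition, since only the empty list is represented by `num 0`. A bound on all
intermediate accumulators has to be assumed: a polynomial-time step may square the size, and
iterating it would leave polynomial time. -/
theorem PolyTime.foldl {l : α → List β} {z : α → σ} {f : α × σ × β → σ} (hl : PolyTime l)
    (hz : PolyTime z) (hf : PolyTime f) {B : α → ℕ} (hB : PolyBdd B)
    (hb : ∀ a l₁ l₂, l a = l₁ ++ l₂ → sz (l₁.foldl (fun s x => f (a, s, x)) (z a)) ≤ B a) :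
    PolyTime fun a => (l a).foldl (fun s x => f (a, s, x)) (z a) := by
  have hbody : PolyTime fun q : (β × List β) × (α × σ) =>
      ((q.1.2, (q.2.1, f (q.2.1, q.2.2, q.1.1))) : List β × (α × σ)) :=
    id.fst.snd.pair (id.snd.fst.pair (hf.comp (id.snd.fst.pair (id.snd.snd.pair id.fst.fst))))
  obtain ⟨d, U, ⟨k, hU⟩, hd⟩ := hbody
  -- A bound on the size of every state of the loop, hence on the argument of every call of the
  -- body.
  let M : α → ℕ := fun a => 3 + sz (l a) + sz a + B a
  have hM : PolyBdd M := (((PolyBdd.const 3).add hl.polyBdd).add .sz).add hB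
  have hloop : ∀ a l₂ l₁, l a = l₁ ++ l₂ → ∃ t,
      t ≤ (l₂.length + 1) * (3 + 2 * M a + (M a + 2) ^ k) ∧
      (RCode.loop (.prim .fst) d).Runs
        (enc (l₂, (a, l₁.foldl (fun s x => f (a, s, x)) (z a))))
        (enc (([] : List β), (a, (l a).foldl (fun s x => f (a, s, x)) (z a)))) t := by
    intro a l₂
    induction l₂ with
    | nil =>
      intro l₁ h
      have hbd := hb a l₁ [] h
      rw [List.append_nil] at h
      rw [h]
      refine ⟨_, ?_, .loopStop (.prim .fst _)⟩
      have hp : sz (([] : List β), (a, l₁.foldl (fun s x => f (a, s, x)) (z a))) ≤ M a := by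
        simp only [sz_pair, sz_nil, M]
        have := one_le_sz (l a)
        omega
      have hM1 : (2 : ℕ) ≤ M a := by simp only [M]; omega
      simp only [sz, enc_pair, enc_nil, RPrim.eval, RVal.size] at hp ⊢
      norm_num at hp ⊢
      omega
    | cons x l₂ ih =>
      intro l₁ h
      have hbd := hb a l₁ (x :: l₂) h
      obtain ⟨t, ht, hr⟩ := ih (l₁ ++ [x]) (by simp [h])
      set s := l₁.foldl (fun s x => f (a, s, x)) (z a) with hs
      obtain ⟨r, hr1, hr2⟩ := hd ((x, l₂), (a, s))
      rw [List.foldl_append, ← hs] at hr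
      simp only [List.foldl_cons, List.foldl_nil] at hr
      have hp : sz ((x, l₂), (a, s)) ≤ M a := by
        have h1 : sz (x :: l₂) ≤ sz (l a) := by
          rw [h]; exact (List.sublist_append_right _ _).sz_le
        simp only [sz_pair, sz_cons, M] at h1 ⊢
        omega
      refine ⟨_, ?_, .loopStep (.prim .fst _) (by simp [RPrim.eval]) hr2 hr⟩
      have hr3 : r ≤ (M a + 2) ^ k :=
        (hr1.trans (hU _)).trans (Nat.pow_le_pow_left (by omega) k)
      rw [List.length_cons, add_mul (l₂.length + 1), one_mul]
      simp only [sz, enc_pair, enc_cons, RPrim.eval, RVal.size] at hp ⊢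
      omega
  have hstart : PolyTime fun a => (l a, (a, z a)) := hl.pair (id.pair hz)
  obtain ⟨e, V, hV, he⟩ := hstart
  obtain ⟨c, W, ⟨j, hW⟩, hc⟩ := (PolyTime.snd'.comp PolyTime.snd' :
    PolyTime fun q : List β × (α × σ) => q.2.2)
  refine ⟨.seq e (.seq (.loop (.prim .fst) d) c),
    fun a => 1 + V a + (1 + (sz (l a) + 1) * (3 + 2 * M a + (M a + 2) ^ k) + (M a + 2) ^ j),
    ((PolyBdd.const 1).add hV).add (((PolyBdd.const 1).add ((hl.polyBdd.add (.const 1)).mul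
      (((PolyBdd.const 3).add ((PolyBdd.const 2).mul hM)).add
        ((hM.add (.const 2)).pow k)))).add ((hM.add (.const 2)).pow j)), fun a => ?_⟩
  obtain ⟨r, hr1, hr2⟩ := he a
  obtain ⟨s, hs1, hs2⟩ := hloop a (l a) [] rfl
  obtain ⟨t, ht1, ht2⟩ := hc (([] : List β), (a, (l a).foldl (fun s x => f (a, s, x)) (z a)))
  refine ⟨_, ?_, hr2.seq (hs2.seq ht2)⟩
  have h1 : s ≤ (sz (l a) + 1) * (3 + 2 * M a + (M a + 2) ^ k) :=
    hs1.trans (Nat.mul_le_mul_right _ (Nat.add_le_add_right (length_le_sz _) 1))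
  have h2 : t ≤ (M a + 2) ^ j := by
    refine (ht1.trans (hW _)).trans (Nat.pow_le_pow_left ?_ j)
    have := hb a (l a) [] (by simp)
    have := one_le_sz (l a)
    simp only [sz_pair, sz_nil, M]
    omega
  dsimp only
  omega

theorem PolyTime.reverse {l : α → List β} (hl : PolyTime l) : PolyTime fun a => (l a).reverse := by
  have h : ∀ l : List β, l.foldl (fun s x => x :: s) [] = l.reverse := fun l => by
    simp
  have := PolyTime.foldl hl (.const ([] : List β)) (f := fun p => p.2.2 :: p.2.1)
    (id.snd.snd.cons id.snd.fst) hl.polyBdd (fun a l₁ l₂ h' => by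
      dsimp only
      rw [h, (List.reverse_perm l₁).sz_eq, h']
      exact (List.sublist_append_left _ _).sz_le)
  simpa only [h] using this

theorem PolyTime.foldr {l : α → List β} {z : α → σ} {f : α × σ × β → σ} (hl : PolyTime l)
    (hz : PolyTime z) (hf : PolyTime f) {B : α → ℕ} (hB : PolyBdd B)
    (hb : ∀ a l₂, l₂ <:+ l a → sz (l₂.foldr (fun x s => f (a, s, x)) (z a)) ≤ B a) :
    PolyTime fun a => (l a).foldr (fun x s => f (a, s, x)) (z a) := by
  simp only [List.foldr_eq_foldl_reverse]
  refine PolyTime.foldl hl.reverse hz hf hB fun a l₁ l₂ h => ?_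
  have := hb a l₁.reverse ⟨l₂.reverse, by rw [← List.reverse_append, ← h, List.reverse_reverse]⟩
  rwa [List.foldr_eq_foldl_reverse, List.reverse_reverse] at this

/-- A fold is polynomial-time if every step increases a measure of the size of the state by a
polynomially bounded amount. -/
theorem PolyTime.foldr_of_measure {l : α → List β} {z : α → σ} {f : α × σ × β → σ}
    (hl : PolyTime l) (hz : PolyTime z) (hf : PolyTime f) (μ : σ → ℕ)
    (hμ : ∀ s, sz s ≤ 2 * μ s + 1) (hμz : PolyBdd fun a => μ (z a)) {K : α → ℕ} (hK : PolyBdd K)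
    (hb : ∀ a s x, x ∈ l a → μ (f (a, s, x)) ≤ μ s + K a) :
    PolyTime fun a => (l a).foldr (fun x s => f (a, s, x)) (z a) := by
  have key : ∀ a l₂, l₂ <:+ l a →
      μ (l₂.foldr (fun x s => f (a, s, x)) (z a)) ≤ μ (z a) + l₂.length * K a := by
    intro a l₂
    induction l₂ with
    | nil => simp
    | cons x l₂ ih =>
      intro h
      have h1 := ih ((List.suffix_cons x l₂).trans h)
      have h2 := hb a (l₂.foldr (fun x s => f (a, s, x)) (z a)) x (h.subset (by simp))
      rw [List.foldr_cons, List.length_cons, add_mul]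
      omega
  refine PolyTime.foldr hl hz hf (B := fun a => 2 * (μ (z a) + sz (l a) * K a) + 1)
    (((PolyBdd.const 2).mul (hμz.add (hl.polyBdd.mul hK))).add (.const 1)) fun a l₂ h => ?_
  have h1 := key a l₂ h
  have h2 := hμ (l₂.foldr (fun x s => f (a, s, x)) (z a))
  have h3 : l₂.length * K a ≤ sz (l a) * K a :=
    Nat.mul_le_mul_right _ (h.length_le.trans (length_le_sz _))
  omega

/-- A fold is polynomial-time if every step increases the size of the state by a polynomially
bounded amount. -/
theorem PolyTime.foldr_of_growth {l : α → List β} {z : α → σ} {f : α × σ × β → σ}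
    (hl : PolyTime l) (hz : PolyTime z) (hf : PolyTime f) {K : α → ℕ} (hK : PolyBdd K)
    (hb : ∀ a s x, x ∈ l a → sz (f (a, s, x)) ≤ sz s + K a) :
    PolyTime fun a => (l a).foldr (fun x s => f (a, s, x)) (z a) :=
  .foldr_of_measure hl hz hf sz (fun s => by omega) hz.polyBdd hK hb

/-- The size of `f (a, x)` for `x` in a list computed from `a`. -/
theorem PolyTime.exists_bdd_of_mem {l : α → List β} {f : α × β → γ} (hl : PolyTime l)
    (hf : PolyTime f) : ∃ K : α → ℕ, PolyBdd K ∧ ∀ a, ∀ x ∈ l a, sz (f (a, x)) ≤ K a := by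
  obtain ⟨k, hk⟩ := hf.polyBdd
  refine ⟨fun a => (1 + sz a + sz (l a) + 2) ^ k,
    ((((PolyBdd.const 1).add .sz).add hl.polyBdd).add (.const 2)).pow k, fun a x hx => ?_⟩
  refine (hk (a, x)).trans (Nat.pow_le_pow_left ?_ k)
  have := sz_le_of_mem hx
  rw [sz_pair]
  omega

theorem PolyTime.append {l₁ l₂ : α → List β} (h₁ : PolyTime l₁) (h₂ : PolyTime l₂) :
    PolyTime fun a => l₁ a ++ l₂ a := by
  have := PolyTime.foldr_of_growth h₁ h₂ (f := fun p => p.2.2 :: p.2.1) (id.snd.snd.cons id.snd.fst)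
    (K := fun a => 1 + sz (l₁ a)) ((PolyBdd.const 1).add h₁.polyBdd) (fun a s x hx => by
      have := sz_le_of_mem hx
      simp only [sz_cons]
      omega)
  simpa using this

theorem PolyTime.map {l : α → List β} {f : α → β → γ} (hl : PolyTime l)
    (hf : PolyTime fun p : α × β => f p.1 p.2) : PolyTime fun a => (l a).map (f a) := by
  obtain ⟨K, hK, hb⟩ := hl.exists_bdd_of_mem hf
  have := PolyTime.foldr_of_growth hl (.const ([] : List γ))
    (f := fun p : α × List γ × β => f p.1 p.2.2 :: p.2.1)
    ((hf.comp (id.fst.pair id.snd.snd)).cons id.snd.fst)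
    (K := fun a => 1 + K a) ((PolyBdd.const 1).add hK) (fun a s x hx => by
      have := hb a x hx
      rw [sz_cons]
      dsimp only at this ⊢
      omega)
  convert this using 2 with a
  induction l a with
  | nil => rfl
  | cons x l ih => rw [List.map_cons, ih, List.foldr_cons]

theorem PolyTime.flatMap {l : α → List β} {f : α → β → List γ} (hl : PolyTime l)
    (hf : PolyTime fun p : α × β => f p.1 p.2) : PolyTime fun a => (l a).flatMap (f a) := by
  obtain ⟨K, hK, hb⟩ := hl.exists_bdd_of_mem hf
  have := PolyTime.foldr_of_growth hl (.const ([] : List γ))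
    (f := fun p => f p.1 p.2.2 ++ p.2.1) ((hf.comp (id.fst.pair id.snd.snd)).append id.snd.fst)
    hK (fun a s x hx => by
      have := hb a x hx
      have := sz_append (f a x) s
      dsimp only at *
      omega)
  convert this using 2 with a
  induction l a with
  | nil => rfl
  | cons x l ih => rw [List.flatMap_cons, ih, List.foldr_cons]

theorem PolyTime.filter {l : α → List β} {p : α → β → Prop} [∀ a, DecidablePred (p a)]
    (hl : PolyTime l) (hp : PolyDec fun q : α × β => p q.1 q.2) :
    PolyTime fun a => (l a).filter fun x => p a x := by
  have : DecidablePred fun q : α × List β × β => p q.1 q.2.2 := fun q => inferInstance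
  have := PolyTime.foldr_of_growth hl (.const ([] : List β))
    (f := fun q => if p q.1 q.2.2 then q.2.2 :: q.2.1 else q.2.1)
    (.ite (hp.comp (id.fst.pair id.snd.snd)) (id.snd.snd.cons id.snd.fst) id.snd.fst)
    (K := fun a => 1 + sz (l a)) ((PolyBdd.const 1).add hl.polyBdd) (fun a s x hx => by
      have := sz_le_of_mem hx
      by_cases h : p a x
      · simp only [h, if_true, sz_cons]
        omega
      · simp only [h, if_false]
        omega)
  convert this using 2 with a
  induction l a with
  | nil => rfl
  | cons x l ih =>
    rw [List.filter_cons, ih, List.foldr_cons]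
    simp

theorem PolyDec.exists_mem {l : α → List β} {p : α → β → Prop}
    (hl : PolyTime l) (hp : PolyDec fun q : α × β => p q.1 q.2) :
    PolyDec fun a => ∃ x ∈ l a, p a x := by
  classical
  refine ⟨fun a => (l a).foldr (fun x s => if p a x then true else s) false,
    PolyTime.foldr_of_growth hl (.const false)
    (f := fun q => if p q.1 q.2.2 then true else q.2.1)
    (.ite (hp.comp (PolyTime.id.fst.pair PolyTime.id.snd.snd)) (.const true) PolyTime.id.snd.fst)
    (K := fun a => sz true) (.const _) (fun a s x hx => by
      by_cases h : p a x
      · simp only [h, if_true]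
        omega
      · simp only [h, if_false]
        omega), fun a => ?_⟩
  dsimp only
  induction l a with
  | nil => simp
  | cons x l ih =>
    rw [List.foldr_cons]
    by_cases h : p a x
    · simp [h]
    · simpa only [h, if_false, List.mem_cons, exists_eq_or_imp, false_or] using ih

/-- The growth is measured by `Rat.bits`, whose exact subadditivity makes partial sums grow
linearly. A constant factor lost at each addition would compound. -/
theorem PolyTime.list_sum {l : α → List ℚ} (hl : PolyTime l) : PolyTime fun a => (l a).sum := by
  have := PolyTime.foldr_of_measure hl (.const (0 : ℚ)) (f := fun p => p.2.2 + p.2.1)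
    (id.snd.snd.add id.snd.fst) Rat.bits sz_rat_le (.const _) (K := fun a => sz (l a) + 1)
    (hl.polyBdd.add (.const 1)) (fun a s x hx => by
      have h1 := sz_le_of_mem hx
      have h2 := x.bits_le
      have h3 := Rat.bits_add_le x s
      dsimp only
      omega)
  exact this

theorem PolyTime.length {l : α → List β} (hl : PolyTime l) : PolyTime fun a => (l a).length := by
  have := (hl.map (f := fun _ _ => (1 : ℚ)) (.const _)).list_sum
  refine .of_natCast ?_
  simpa using this

theorem PolyTime.list_cases {l : α → List β} {f : α → γ} {g : α → β → List β → γ}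
    (hl : PolyTime l) (hf : PolyTime f)
    (hg : PolyTime fun q : α × β × List β => g q.1 q.2.1 q.2.2) :
    PolyTime fun a => match l a with
      | [] => f a
      | x :: l' => g a x l' := by
  obtain ⟨e, V, hV, he⟩ := hl
  obtain ⟨c, T, hT, hc⟩ := hf
  obtain ⟨d, U, ⟨k, hU⟩, hd⟩ := hg
  have hlB : PolyBdd fun a => sz (l a) := hV.mono fun a =>
    let ⟨t, ht, hr⟩ := he a
    hr.size_le.2.trans ht
  -- The result of the test is not passed to the branches, so the nonempty branch computes the list
  -- a second time.
  refine ⟨.cond e (.seq (.fork (.prim .id) e) d) c, fun a =>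
    1 + V a + (T a + (1 + (1 + (1 + sz a + sz a) + V a) + (1 + sz a + sz (l a) + 2) ^ k)), ?_,
    fun a => ?_⟩
  · exact ((PolyBdd.const 1).add hV).add (hT.add (((PolyBdd.const 1).add
      (((PolyBdd.const 1).add (((PolyBdd.const 1).add .sz).add .sz)).add hV)).add
        (((((PolyBdd.const 1).add .sz).add hlB).add (.const 2)).pow k)))
  obtain ⟨r, hr, hv⟩ := he a
  dsimp only
  cases h : l a with
  | nil =>
    rw [h] at hv
    obtain ⟨t, ht, hq⟩ := hc a
    exact ⟨1 + r + t, by simp only [h] at *; omega, .condFalse hv hq⟩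
  | cons x l' =>
    rw [h] at hv
    obtain ⟨t, ht, hq⟩ := hd (a, x, l')
    have h1 : t ≤ (1 + sz a + sz (x :: l') + 2) ^ k := by
      refine (ht.trans (hU _)).trans (Nat.pow_le_pow_left ?_ k)
      simp only [sz_pair, sz_cons]
      omega
    refine ⟨_, ?_, .condTrue hv (by simp) (((RCode.Runs.prim .id (enc a)).fork hv).seq hq)⟩
    change 1 + r + (1 + (1 + (1 + sz a + sz a) + r) + t) ≤ _
    omega

end Fold

/-! ### Search and enumeration -/

section Search

variable {α β σ ι : Type} [Enc α] [Enc β] [Enc σ] [Enc ι]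

theorem PolyTime.vec_cons {n : ℕ} {f : α → β} {g : α → Fin n → β} (hf : PolyTime f)
    (hg : PolyTime g) : PolyTime fun a => (Fin.cons (f a) (g a) : Fin (n + 1) → β) :=
  .vec fun i => Fin.cases (by simpa using hf) (fun i => by simpa using hg.get i) i

/-- The elements of a list with their distances to the end of the list. -/
def numbered : List β → List (ℕ × β)
  | [] => []
  | x :: l => (l.length, x) :: numbered l

omit [Enc β] in
theorem length_numbered (l : List β) : (numbered l).length = l.length := by
  induction l with
  | nil => rfl
  | cons x l ih => simp [numbered, ih]

omit [Enc β] in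
theorem map_fst_numbered (l : List β) :
    (numbered l).map Prod.fst = (List.range l.length).reverse := by
  induction l with
  | nil => rfl
  | cons x l ih => simp [numbered, ih, List.range_succ]

omit [Enc β] in
-- A right fold naturally counts from the end of a list; reversing the list beforehand turns these
-- numbers into ordinary indices.
theorem mem_numbered_reverse {l : List β} {i : ℕ} {x : β} :
    (i, x) ∈ numbered l.reverse ↔ l[i]? = some x := by
  induction l using List.reverseRecOn with
  | nil => simp [numbered]
  | append_singleton l y ih =>
    rw [List.reverse_append, List.reverse_singleton, List.singleton_append, numbered,
      List.mem_cons, ih, List.length_reverse, Prod.mk.injEq, List.getElem?_append]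
    split_ifs with h
    · simp [h.ne]
    · have h' : l[i]? = none := by simpa using h
      simp only [h', reduceCtorEq, or_false]
      rcases (not_lt.1 h).eq_or_lt with h2 | h2
      · simp [← h2, eq_comm]
      · have : ([y] : List β)[i - l.length]? = none := by simp; omega
        simp [this, h2.ne']

omit [Enc β] in
theorem mem_numbered_ofFn {n : ℕ} {f : Fin n → β} {e : ℕ × β} :
    e ∈ numbered (List.ofFn f).reverse ↔ ∃ i : Fin n, e = ((i : ℕ), f i) := by
  obtain ⟨j, x⟩ := e
  rw [mem_numbered_reverse, List.getElem?_eq_some_iff]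
  constructor
  · rintro ⟨h, rfl⟩
    exact ⟨⟨j, by simpa using h⟩, by simp⟩
  · rintro ⟨i, h⟩
    obtain ⟨rfl, rfl⟩ := Prod.mk.inj h
    exact ⟨by simp, by simp⟩

theorem sz_nat_le (n : ℕ) : sz n ≤ 2 + n := by
  have h : n.size ≤ n := Nat.size_le.2 Nat.lt_two_pow_self
  simp only [sz, enc, RVal.size, Rat.num_natCast, Int.natAbs_natCast, Rat.den_natCast,
    Nat.size_one]
  omega

theorem PolyTime.numbered {l : α → List β} (hl : PolyTime l) :
    PolyTime fun a => _root_.numbered (l a) := by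
  have heq : ∀ l : List β, l.foldr (fun x s => (s.length, x) :: s) [] = _root_.numbered l := by
    intro l
    induction l with
    | nil => rfl
    | cons x l ih => rw [List.foldr_cons, ih, length_numbered, _root_.numbered]
  have hsz : ∀ l : List β, sz (_root_.numbered l) ≤ sz l + l.length * (3 + l.length) := by
    intro l
    induction l with
    | nil => simp [_root_.numbered]
    | cons x l ih =>
      have := sz_nat_le l.length
      simp only [_root_.numbered, sz_cons, sz_pair, List.length_cons]
      nlinarith
  have := PolyTime.foldr hl (.const ([] : List (ℕ × β)))
    (f := fun p => (p.2.1.length, p.2.2) :: p.2.1)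
    ((id.snd.fst.length.pair id.snd.snd).cons id.snd.fst)
    (B := fun a => sz (l a) + sz (l a) * (3 + sz (l a)))
    (hl.polyBdd.add (hl.polyBdd.mul ((PolyBdd.const 3).add hl.polyBdd))) (fun a l₂ h => by
      dsimp only
      rw [heq]
      have h1 := h.sublist.sz_le
      have h2 := length_le_sz l₂
      exact (hsz l₂).trans (Nat.add_le_add h1 (Nat.mul_le_mul (h2.trans h1) (by omega))))
  simpa only [heq] using this

/-- An element of `z :: l` with the largest value of `p`. -/
def best (p : σ → ℚ) (z : σ) (l : List σ) : σ := l.foldr (fun x s => if p s ≤ p x then x else s) z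

omit [Enc σ] in
theorem best_mem (p : σ → ℚ) (z : σ) (l : List σ) : best p z l ∈ z :: l := by
  induction l with
  | nil => simp [best]
  | cons x l ih =>
    change (if p (best p z l) ≤ p x then x else best p z l) ∈ _
    split_ifs
    · simp
    · rcases List.mem_cons.1 ih with h | h
      · simp [h]
      · simp [h]

omit [Enc σ] in
theorem le_best (p : σ → ℚ) (z : σ) (l : List σ) : ∀ x ∈ z :: l, p x ≤ p (best p z l) := by
  induction l with
  | nil => simp [best]
  | cons x l ih =>
    intro y hy
    change p y ≤ p (if p (best p z l) ≤ p x then x else best p z l)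
    have hy' : y = x ∨ y ∈ z :: l := by
      simp only [List.mem_cons] at hy ⊢
      tauto
    rcases hy' with rfl | hy'
    · split_ifs with h
      · exact le_rfl
      · exact (not_le.1 h).le
    · split_ifs with h
      · exact (ih y hy').trans h
      · exact ih y hy'

theorem PolyTime.best {p : α → σ → ℚ} {z : α → σ} {l : α → List σ}
    (hp : PolyTime fun q : α × σ => p q.1 q.2) (hz : PolyTime z) (hl : PolyTime l) :
    PolyTime fun a => _root_.best (p a) (z a) (l a) :=
  PolyTime.foldr_of_growth hl hz (f := fun q => if p q.1 q.2.1 ≤ p q.1 q.2.2 then q.2.2 else q.2.1)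
    (.ite (.le (hp.comp (id.fst.pair id.snd.fst)) (hp.comp (id.fst.pair id.snd.snd)))
      id.snd.snd id.snd.fst) (K := fun a => sz (l a)) hl.polyBdd (fun a s x hx => by
      have := sz_le_of_mem hx
      dsimp only
      split_ifs <;> omega)

/-- The lists of length at most `k` with entries from `l`. -/
def boundedLists : ℕ → List β → List (List β)
  | 0, _ => [[]]
  | k + 1, l => [] :: l.flatMap fun x => (boundedLists k l).map (x :: ·)

omit [Enc β] in
theorem mem_boundedLists {k : ℕ} {l g : List β} :
    g ∈ boundedLists k l ↔ g.length ≤ k ∧ ∀ x ∈ g, x ∈ l := by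
  induction k generalizing g with
  | zero =>
    simp only [boundedLists, List.mem_singleton, Nat.le_zero, List.length_eq_zero_iff]
    constructor
    · rintro rfl
      simp
    · exact And.left
  | succ k ih =>
    cases g with
    | nil => simp [boundedLists]
    | cons y g =>
      simp only [boundedLists, List.mem_cons, reduceCtorEq, List.mem_flatMap, List.mem_map, ih,
        List.cons.injEq, false_or, List.length_cons, Nat.add_le_add_iff_right,
        forall_eq_or_imp]
      constructor
      · rintro ⟨x, hx, g', ⟨h1, h2⟩, rfl, rfl⟩
        exact ⟨h1, hx, h2⟩
      · rintro ⟨h1, hx, h2⟩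
        exact ⟨y, hx, g, ⟨h1, h2⟩, rfl, rfl⟩

/-- The number `k` is a constant, so the recursion unfolds to a fixed program; the degree of its
time bound depends on `k`. -/
theorem PolyTime.boundedLists (k : ℕ) {l : α → List β} (hl : PolyTime l) :
    PolyTime fun a => _root_.boundedLists k (l a) := by
  induction k with
  | zero => exact .const _
  | succ k ih =>
    exact (PolyTime.const []).cons (hl.flatMap (f := fun a x =>
      (_root_.boundedLists k (l a)).map (x :: ·)) ((ih.comp id.fst).map
        (f := fun (q : α × β) (g : List β) => q.2 :: g) (id.fst.snd.cons id.snd)))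

/-- The vectors of length `k` with entries from `l`. -/
def tuples : (k : ℕ) → List β → List (Fin k → β)
  | 0, _ => [Fin.elim0]
  | k + 1, l => l.flatMap fun x => (tuples k l).map fun v => Fin.cons x v

omit [Enc β] in
theorem mem_tuples {k : ℕ} {l : List β} {v : Fin k → β} :
    v ∈ tuples k l ↔ ∀ i, v i ∈ l := by
  induction k with
  | zero => simp [tuples, Subsingleton.elim v Fin.elim0]
  | succ k ih =>
    simp only [tuples, List.mem_flatMap, List.mem_map, ih]
    constructor
    · rintro ⟨x, hx, w, hw, rfl⟩ i
      refine Fin.cases ?_ (fun i => ?_) i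
      · simpa using hx
      · simpa using hw i
    · intro h
      exact ⟨v 0, h 0, Fin.tail v, fun i => h i.succ, Fin.cons_self_tail v⟩

theorem PolyTime.tuples (k : ℕ) {l : α → List β} (hl : PolyTime l) :
    PolyTime fun a => _root_.tuples k (l a) := by
  induction k with
  | zero => exact .const _
  | succ k ih =>
    exact hl.flatMap (f := fun a x => (_root_.tuples k (l a)).map fun v => Fin.cons x v)
      ((ih.comp id.fst).map (f := fun (q : α × β) v => (Fin.cons q.2 v : Fin (k + 1) → β))
        (id.fst.snd.vec_cons id.snd))

/-! ### Dynamic programming over the selections from a list -/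

section Table

variable {κ : Type} [DecidableEq κ] (key : List ι → κ) (p : List ι → ℚ)

/-- For every value of `key`, keep a selection with the largest value of `p`. -/
def prune (l : List (List ι)) : List (List ι) :=
  l.foldr (fun T s => if ∃ T' ∈ s, key T' = key T ∧ p T ≤ p T' then s
    else T :: s.filter fun T' => key T' ≠ key T) []

/-- Selections from `l`, one with the largest value of `p` for every value of `key`. -/
def bestSelections : List ι → List (List ι)
  | [] => [[]]
  | x :: l => prune key p (bestSelections l ++ (bestSelections l).map (x :: ·))

omit [Enc ι] in
theorem prune_cons (T : List ι) (l : List (List ι)) :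
    prune key p (T :: l) = if ∃ T' ∈ prune key p l, key T' = key T ∧ p T ≤ p T' then prune key p l
      else T :: (prune key p l).filter fun T' => key T' ≠ key T := rfl

omit [Enc ι] in
theorem prune_subset (l : List (List ι)) : ∀ T ∈ prune key p l, T ∈ l := by
  induction l with
  | nil => simp [prune]
  | cons T l ih =>
    intro T' hT'
    rw [prune_cons] at hT'
    split_ifs at hT'
    · exact List.mem_cons_of_mem _ (ih _ hT')
    · rcases List.mem_cons.1 hT' with rfl | h
      · simp
      · exact List.mem_cons_of_mem _ (ih _ (List.mem_of_mem_filter h))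

omit [Enc ι] in
theorem nodup_map_key_prune (l : List (List ι)) : ((prune key p l).map key).Nodup := by
  induction l with
  | nil => simp [prune]
  | cons T l ih =>
    rw [prune_cons]
    split_ifs
    · exact ih
    · rw [List.map_cons, List.nodup_cons]
      refine ⟨?_, ih.sublist (List.filter_sublist.map _)⟩
      simp only [List.mem_map, List.mem_filter, not_exists, not_and, decide_eq_true_eq]
      exact fun T' h => h.2

omit [Enc ι] in
theorem exists_mem_prune {l : List (List ι)} {T : List ι} (hT : T ∈ l) :
    ∃ T' ∈ prune key p l, key T' = key T ∧ p T ≤ p T' := by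
  induction l with
  | nil => simp at hT
  | cons U l ih =>
    rw [prune_cons]
    rcases List.mem_cons.1 hT with rfl | hT
    · split_ifs with h
      · exact h
      · exact ⟨T, by simp⟩
    · obtain ⟨T', h1, h2, h3⟩ := ih hT
      split_ifs with h
      · exact ⟨T', h1, h2, h3⟩
      · by_cases hk : key T' = key U
        · push Not at h
          exact ⟨U, by simp, hk.symm.trans h2, h3.trans (h T' h1 hk).le⟩
        · exact ⟨T', by simp [h1, hk], h2, h3⟩

omit [Enc ι] in
theorem sublist_of_mem_bestSelections {l T : List ι} (hT : T ∈ bestSelections key p l) :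
    T.Sublist l := by
  induction l generalizing T with
  | nil => simp_all [bestSelections]
  | cons x l ih =>
    rcases List.mem_append.1 (prune_subset key p _ _ hT) with h | h
    · exact (ih h).cons x
    · obtain ⟨T', h', rfl⟩ := List.mem_map.1 h
      exact (ih h').cons_cons x

omit [Enc ι] in
theorem nodup_map_key_bestSelections (l : List ι) : ((bestSelections key p l).map key).Nodup := by
  cases l with
  | nil => simp [bestSelections]
  | cons x l => exact nodup_map_key_prune key p _

omit [Enc ι] in
-- An exchange argument. By the two hypotheses, replacing a tail by one with the same key and at
-- least the same value stays harmless whatever is prepended later, so pruning at each stage loses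
-- nothing.
theorem exists_mem_bestSelections
    (hkey : ∀ x T T', key T = key T' → key (x :: T) = key (x :: T'))
    (hp : ∀ x T T', p T ≤ p T' → p (x :: T) ≤ p (x :: T')) {l Q : List ι} (hQ : Q.Sublist l) :
    ∃ T ∈ bestSelections key p l, key T = key Q ∧ p Q ≤ p T := by
  induction hQ with
  | slnil => exact ⟨[], by simp [bestSelections]⟩
  | cons x _ ih =>
    obtain ⟨T, h1, h2, h3⟩ := ih
    obtain ⟨T', h4, h5, h6⟩ := exists_mem_prune key p
      (List.mem_append_left ((bestSelections key p _).map (x :: ·)) h1)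
    exact ⟨T', h4, h5.trans h2, h3.trans h6⟩
  | cons_cons x _ ih =>
    obtain ⟨T, h1, h2, h3⟩ := ih
    obtain ⟨T', h4, h5, h6⟩ := exists_mem_prune key p
      (List.mem_append_right (bestSelections key p _) (List.mem_map_of_mem (f := (x :: ·)) h1))
    exact ⟨T', h4, h5.trans (hkey _ _ _ h2), (hp _ _ _ h3).trans h6⟩

end Table

theorem PolyTime.prune {D : ℕ} {key : α → List ι → Fin D → ℚ} {p : List ι → ℚ}
    {l : α → List (List ι)} (hkey : PolyTime fun q : α × List ι => key q.1 q.2) (hp : PolyTime p)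
    (hl : PolyTime l) : PolyTime fun a => _root_.prune (key a) p (l a) := by
  have hk : ∀ {δ : Type} [Enc δ] {f : δ → α} {T T' : δ → List ι}, PolyTime f → PolyTime T →
      PolyTime T' → PolyDec fun d => key (f d) (T d) = key (f d) (T' d) := by
    intro δ _ f T T' hf hT hT'
    exact (PolyDec.forall_fin fun i => PolyDec.eq ((hkey.comp (hf.pair hT)).get i)
      ((hkey.comp (hf.pair hT')).get i)).of_iff fun d => funext_iff
  exact PolyTime.foldr_of_growth hl (.const ([] : List (List ι)))
    (f := fun q => if ∃ T' ∈ q.2.1, key q.1 T' = key q.1 q.2.2 ∧ p q.2.2 ≤ p T' then q.2.1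
      else q.2.2 :: q.2.1.filter fun T' => key q.1 T' ≠ key q.1 q.2.2)
    (.ite (.exists_mem (p := fun q T' => key q.1 T' = key q.1 q.2.2 ∧ p q.2.2 ≤ p T')
        id.snd.fst ((hk id.fst.fst id.snd id.fst.snd.snd).and
          (.le (hp.comp id.fst.snd.snd) (hp.comp id.snd)))) id.snd.fst
      (id.snd.snd.cons (.filter (p := fun q T' => key q.1 T' ≠ key q.1 q.2.2) id.snd.fst
        (hk id.fst.fst id.snd id.fst.snd.snd).not)))
    (K := fun a => 1 + sz (l a)) ((PolyBdd.const 1).add hl.polyBdd) (fun a s T hT => by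
      have h1 := sz_le_of_mem hT
      have h2 := (List.filter_sublist (l := s) (p := fun T' => key a T' ≠ key a T)).sz_le
      dsimp only
      split_ifs
      · omega
      · rw [sz_cons]
        omega)

/-- The table never has two entries with the same key. A polynomial bound on the number of possible
keys therefore keeps it small, although there are exponentially many selections. -/
theorem PolyTime.bestSelections {D : ℕ} {key : α → List ι → Fin D → ℚ} {p : List ι → ℚ}
    {l : α → List ι} (hkey : PolyTime fun q : α × List ι => key q.1 q.2) (hp : PolyTime p)
    (hl : PolyTime l) {C : α → ℕ} (hC : PolyBdd C)
    (hcard : ∀ a, ∃ S : Finset (Fin D → ℚ), S.card ≤ C a ∧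
      ∀ T, T.Sublist (l a) → key a T ∈ S) :
    PolyTime fun a => _root_.bestSelections (key a) p (l a) := by
  have heq : ∀ a (l : List ι), l.foldr (fun x s => _root_.prune (key a) p (s ++ s.map (x :: ·)))
      [[]] = _root_.bestSelections (key a) p l := by
    intro a l
    induction l with
    | nil => rfl
    | cons x l ih => rw [List.foldr_cons, ih, _root_.bestSelections]
  have := PolyTime.foldr hl (.const [[]])
    (f := fun q => _root_.prune (key q.1) p (q.2.1 ++ q.2.1.map (q.2.2 :: ·)))
    (PolyTime.prune (key := fun (q : α × List (List ι) × ι) => key q.1)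
      (hkey.comp (id.fst.fst.pair id.snd)) hp (id.snd.fst.append
        (id.snd.fst.map (f := fun (q : α × List (List ι) × ι) T => q.2.2 :: T)
          (id.fst.snd.snd.cons id.snd))))
    (B := fun a => 2 + C a * (1 + sz (l a)))
    ((PolyBdd.const 2).add (hC.mul ((PolyBdd.const 1).add hl.polyBdd))) (fun a l₂ h => by
      dsimp only
      rw [heq]
      refine (sz_le_of_forall_mem (n := sz (l a)) fun T hT =>
        ((sublist_of_mem_bestSelections _ _ hT).trans h.sublist).sz_le).trans ?_
      refine Nat.add_le_add_left (Nat.mul_le_mul_right _ ?_) _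
      obtain ⟨S, hS, hmem⟩ := hcard a
      refine le_trans ?_ hS
      rw [← List.length_map (key a),
        ← List.toFinset_card_of_nodup (nodup_map_key_bestSelections (key a) p l₂)]
      refine Finset.card_le_card fun x hx => ?_
      obtain ⟨T, hT, rfl⟩ := List.mem_map.1 (List.mem_toFinset.1 hx)
      exact hmem T ((sublist_of_mem_bestSelections _ _ hT).trans h.sublist))
  simpa only [heq] using this

/-- Drop the entries of a list whose number occurs again later. -/
def distinctNumbers (l : List (ℕ × β)) : List (ℕ × β) :=
  l.foldr (fun x s => if ∃ y ∈ s, y.1 = x.1 then s else x :: s) []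

omit [Enc β] in
theorem distinctNumbers_cons (x : ℕ × β) (l : List (ℕ × β)) :
    distinctNumbers (x :: l) = if ∃ y ∈ distinctNumbers l, y.1 = x.1 then distinctNumbers l
      else x :: distinctNumbers l := rfl

omit [Enc β] in
theorem distinctNumbers_sublist (l : List (ℕ × β)) : (distinctNumbers l).Sublist l := by
  induction l with
  | nil => exact List.Sublist.slnil
  | cons x l ih =>
    rw [distinctNumbers_cons]
    split_ifs
    · exact ih.cons x
    · exact ih.cons_cons x

omit [Enc β] in
-- Guesses range over all short lists, including those with repetitions; this cleaning turns each of
-- them into a genuine set of items.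
theorem nodup_map_fst_distinctNumbers (l : List (ℕ × β)) :
    ((distinctNumbers l).map Prod.fst).Nodup := by
  induction l with
  | nil => simp [distinctNumbers]
  | cons x l ih =>
    rw [distinctNumbers_cons]
    split_ifs with h
    · exact ih
    · rw [List.map_cons, List.nodup_cons]
      refine ⟨fun hx => h ?_, ih⟩
      obtain ⟨y, hy, hyx⟩ := List.mem_map.1 hx
      exact ⟨y, hy, hyx⟩

omit [Enc β] in
theorem distinctNumbers_eq_self {l : List (ℕ × β)} (h : (l.map Prod.fst).Nodup) :
    distinctNumbers l = l := by
  induction l with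
  | nil => rfl
  | cons x l ih =>
    rw [List.map_cons, List.nodup_cons] at h
    rw [distinctNumbers_cons, ih h.2, if_neg]
    rintro ⟨y, hy, hyx⟩
    exact h.1 (List.mem_map.2 ⟨y, hy, hyx⟩)

theorem PolyTime.distinctNumbers {l : α → List (ℕ × β)} (hl : PolyTime l) :
    PolyTime fun a => _root_.distinctNumbers (l a) :=
  PolyTime.foldr_of_growth hl (.const ([] : List (ℕ × β)))
    (f := fun q => if ∃ y ∈ q.2.1, y.1 = q.2.2.1 then q.2.1 else q.2.2 :: q.2.1)
    (.ite (.exists_mem (p := fun (q : α × List (ℕ × β) × (ℕ × β)) y => y.1 = q.2.2.1) id.snd.fst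
      (.nat_eq id.snd.fst id.fst.snd.snd.fst)) id.snd.fst (id.snd.snd.cons id.snd.fst))
    (K := fun a => 1 + sz (l a)) ((PolyBdd.const 1).add hl.polyBdd) (fun a s T hT => by
      have h1 := sz_le_of_mem hT
      dsimp only
      split_ifs
      · omega
      · rw [sz_cons]
        omega)

end Search

/-! ### An approximation scheme for vector knapsack -/

/-- A numbered item: its number, its profit and its weights. -/
abbrev VItem (D : ℕ) : Type := ℕ × ℚ × (Fin D → ℚ)

section VectorKnapsack

variable {D : ℕ}

/-- The total weights of the items of `T` in multiples of `μ k / N`, every weight rounded down. -/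
def roundedWeight (N : ℕ) (μ : Fin D → ℚ) (T : List (VItem D)) (k : Fin D) : ℚ :=
  (T.map fun x => ((⌊x.2.2 k * N / μ k⌋ : ℤ) : ℚ)).sum

/-- The total profit of a list of items. -/
def profitSum (T : List (VItem D)) : ℚ := (T.map fun x => x.2.1).sum

/-- The items of `L` that do not occur in `g` and have weights at most `μ`. -/
def lightItems (L g : List (VItem D)) (μ : Fin D → ℚ) : List (VItem D) :=
  L.filter fun x => (¬ ∃ y ∈ g, y.1 = x.1) ∧ ∀ k, 0 ≤ x.2.2 k ∧ x.2.2 k ≤ μ k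

/-- The selections consisting of `g` and of items lighter than those of `r`. -/
def extensions (L g : List (VItem D)) (r : Fin D → VItem D) : List (List (VItem D)) :=
  (bestSelections (roundedWeight L.length fun k => (r k).2.2 k) profitSum
    (lightItems L (distinctNumbers g) fun k => (r k).2.2 k)).map (distinctNumbers g ++ ·)

/-- All selections that are considered when at most `K` items are guessed. -/
def candidates (K : ℕ) (L : List (VItem D)) : List (List (VItem D)) :=
  (boundedLists K L).flatMap fun g =>
    distinctNumbers g :: (tuples D L).flatMap fun r => extensions L g r

/-- The numbers of the items of the best feasible candidate. -/
def approxKnapsack (K : ℕ) (l : List (ℚ × (Fin D → ℚ))) : List ℕ :=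
  (best profitSum [] ((candidates K (numbered l.reverse)).filter fun T =>
    ∀ k, (T.map fun x => x.2.2 k).sum ≤ 1)).map fun x => x.1

/-- The case `μ = 0` is included: the quotient is then 0 by convention. -/
theorem floor_mul_div_mem {N : ℕ} {x μ : ℚ} (h0 : 0 ≤ x) (h1 : x ≤ μ) :
    0 ≤ ⌊x * N / μ⌋ ∧ ⌊x * N / μ⌋ ≤ N := by
  have hμ : 0 ≤ μ := h0.trans h1
  refine ⟨Int.floor_nonneg.2 (by positivity), ?_⟩
  have : x * N / μ ≤ ((N : ℤ) : ℚ) := by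
    push_cast
    refine div_le_of_le_mul₀ hμ (by positivity) ?_
    nlinarith [(Nat.cast_nonneg N : (0 : ℚ) ≤ N)]
  exact_mod_cast (Int.floor_le _).trans this

theorem roundedWeight_mem {N : ℕ} {μ : Fin D → ℚ} {T : List (VItem D)} {k : Fin D}
    (h : ∀ x ∈ T, 0 ≤ x.2.2 k ∧ x.2.2 k ≤ μ k) :
    ∃ m : ℕ, m ≤ T.length * N ∧ roundedWeight N μ T k = m := by
  induction T with
  | nil => exact ⟨0, by simp [roundedWeight]⟩
  | cons x T ih =>
    obtain ⟨m, hm, hT⟩ := ih fun y hy => h y (by simp [hy])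
    obtain ⟨h1, h2⟩ := floor_mul_div_mem (N := N) (h x (by simp)).1 (h x (by simp)).2
    obtain ⟨j, hj⟩ := Int.eq_ofNat_of_zero_le h1
    refine ⟨j + m, ?_, ?_⟩
    · rw [List.length_cons, add_mul]
      omega
    · rw [roundedWeight] at hT ⊢
      rw [List.map_cons, List.sum_cons, hT, hj]
      push_cast
      rfl

/-- Rounding down costs each item at most one unit `μ k / N`. -/
theorem roundedWeight_bounds {N : ℕ} {μ : Fin D → ℚ} {T : List (VItem D)} {k : Fin D}
    (hN : 0 < N) (h : ∀ x ∈ T, 0 ≤ x.2.2 k ∧ x.2.2 k ≤ μ k) :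
    μ k / N * roundedWeight N μ T k ≤ (T.map fun x => x.2.2 k).sum ∧
    (T.map fun x => x.2.2 k).sum ≤ μ k / N * roundedWeight N μ T k + T.length * (μ k / N) := by
  induction T with
  | nil => simp [roundedWeight]
  | cons x T ih =>
    obtain ⟨h1, h2⟩ := ih fun y hy => h y (by simp [hy])
    obtain ⟨h3, h4⟩ := h x (by simp)
    have hN' : (0 : ℚ) < N := by exact_mod_cast hN
    have key : μ k / N * (⌊x.2.2 k * N / μ k⌋ : ℤ) ≤ x.2.2 k ∧
        x.2.2 k ≤ μ k / N * (⌊x.2.2 k * N / μ k⌋ : ℤ) + μ k / N := by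
      -- If `μ k = 0`, the weight is squeezed to 0 and there is no rounding error.
      rcases (h3.trans h4).eq_or_lt with hμ | hμ
      · rw [← hμ] at h4 ⊢
        constructor <;> simp <;> linarith
      · have e : x.2.2 k = μ k / N * (x.2.2 k * N / μ k) := by field_simp
        have hu : 0 < μ k / N := by positivity
        have h5 := mul_le_mul_of_nonneg_left (Int.floor_le (x.2.2 k * N / μ k)) hu.le
        have h6 := mul_le_mul_of_nonneg_left (Int.lt_floor_add_one (x.2.2 k * N / μ k)).le hu.le
        rw [← e] at h5 h6
        exact ⟨h5, by linarith⟩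
    rw [roundedWeight] at h1 h2 ⊢
    simp only [List.map_cons, List.sum_cons, List.length_cons, Nat.cast_add, Nat.cast_one]
    constructor <;> nlinarith [key.1, key.2]

theorem PolyTime.profitSum : PolyTime (profitSum (D := D)) :=
  (PolyTime.id.map (f := fun (_ : List (VItem D)) (x : VItem D) => x.2.1)
    PolyTime.id.snd.snd.fst).list_sum

theorem PolyTime.extensions {α : Type} [Enc α] {L g : α → List (VItem D)}
    {r : α → Fin D → VItem D} (hL : PolyTime L) (hg : PolyTime g) (hr : PolyTime r) :
    PolyTime fun a => _root_.extensions (L a) (g a) (r a) := by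
  have hμ : ∀ k, PolyTime fun a => (r a k).2.2 k := fun k => (hr.get k).snd.snd.get k
  have hd := hg.distinctNumbers
  have hl : PolyTime fun a => lightItems (L a) (_root_.distinctNumbers (g a))
      fun k => (r a k).2.2 k :=
    hL.filter (p := fun a (x : VItem D) => (¬ ∃ y ∈ _root_.distinctNumbers (g a), y.1 = x.1) ∧
        ∀ k, 0 ≤ x.2.2 k ∧ x.2.2 k ≤ (r a k).2.2 k)
      ((PolyDec.exists_mem (p := fun (q : α × VItem D) y => y.1 = q.2.1) (hd.comp id.fst)
        (.nat_eq id.snd.fst id.fst.snd.fst)).not.and (.forall_fin fun k =>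
          (PolyDec.le (.const 0) (id.snd.snd.snd.get k)).and
            (.le (id.snd.snd.snd.get k) ((hμ k).comp id.fst))))
  refine (PolyTime.bestSelections (key := fun a => roundedWeight (L a).length
      fun k => (r a k).2.2 k) (p := _root_.profitSum) ?_ PolyTime.profitSum hl
      (C := fun a => (sz (L a) * sz (L a) + 1) ^ D)
      (((hL.polyBdd.mul hL.polyBdd).add (.const 1)).pow D) fun a => ?_).map
      (f := fun a T => _root_.distinctNumbers (g a) ++ T) ((hd.comp id.fst).append id.snd)
  · refine .vec fun k => PolyTime.list_sum (id.snd.map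
      (f := fun (q : α × List (VItem D)) (x : VItem D) =>
        ((⌊x.2.2 k * (L q.1).length / (r q.1 k).2.2 k⌋ : ℤ) : ℚ)) ?_)
    exact (((id.snd.snd.snd.get k).mul (hL.length.natCast.comp id.fst.fst)).div
      ((hμ k).comp id.fst.fst)).floor
  · classical
    -- Each coordinate of a key is a natural number at most (number of selected items) times (number
    -- of items), and both factors are at most `sz (L a)`.
    refine ⟨Fintype.piFinset fun _ => (Finset.range (sz (L a) * sz (L a) + 1)).image
      fun m : ℕ => (m : ℚ), ?_, fun T hT => ?_⟩
    · rw [Fintype.card_piFinset_const]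
      exact Nat.pow_le_pow_left (Finset.card_image_le.trans (by simp)) D
    · rw [Fintype.mem_piFinset]
      intro k
      obtain ⟨m, hm, he⟩ := roundedWeight_mem (N := (L a).length)
        (μ := fun k => (r a k).2.2 k) (T := T) (k := k) fun x hx => by
          have := hT.subset hx
          simp only [lightItems, List.mem_filter, decide_eq_true_eq] at this
          exact this.2.2 k
      rw [he, Finset.mem_image]
      refine ⟨m, ?_, rfl⟩
      have h1 := length_le_sz (L a)
      have h2 : T.length ≤ sz (L a) :=
        (hT.length_le.trans (List.length_filter_le _ _)).trans h1
      have := hm.trans (Nat.mul_le_mul h2 h1)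
      rw [Finset.mem_range]
      omega

theorem PolyTime.candidates (K : ℕ) : PolyTime (candidates (D := D) K) :=
  (PolyTime.boundedLists K id).flatMap (f := fun L g => _root_.distinctNumbers g ::
      (_root_.tuples D L).flatMap fun r => _root_.extensions L g r)
    (id.snd.distinctNumbers.cons ((PolyTime.tuples D id.fst).flatMap
      (f := fun (q : List (VItem D) × List (VItem D)) r => _root_.extensions q.1 q.2 r)
      (PolyTime.extensions id.fst.fst id.fst.snd id.snd)))

theorem PolyTime.approxKnapsack (K : ℕ) : PolyTime (approxKnapsack (D := D) K) := by
  have hc : PolyTime fun l : List (ℚ × (Fin D → ℚ)) =>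
      _root_.candidates K (_root_.numbered l.reverse) :=
    (PolyTime.candidates K).comp id.reverse.numbered
  have hw : ∀ k, PolyTime fun T : List (VItem D) => (T.map fun x => x.2.2 k).sum := fun k =>
    PolyTime.list_sum (id.map (f := fun (_ : List (VItem D)) (x : VItem D) => x.2.2 k)
      (id.snd.snd.snd.get k))
  have hf : PolyTime fun l : List (ℚ × (Fin D → ℚ)) =>
      (_root_.candidates K (_root_.numbered l.reverse)).filter fun T =>
        ∀ k, (T.map fun x => x.2.2 k).sum ≤ 1 :=
    hc.filter (p := fun _ (T : List (VItem D)) => ∀ k, (T.map fun x => x.2.2 k).sum ≤ 1)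
      (.forall_fin fun k => .le ((hw k).comp id.snd) (.const 1))
  have hb : PolyTime fun l : List (ℚ × (Fin D → ℚ)) => _root_.best _root_.profitSum []
      ((_root_.candidates K (_root_.numbered l.reverse)).filter fun T =>
        ∀ k, (T.map fun x => x.2.2 k).sum ≤ 1) :=
    PolyTime.best (p := fun _ => _root_.profitSum) (PolyTime.profitSum.comp id.snd) (.const []) hf
  exact hb.map (f := fun _ (x : VItem D) => x.1) id.snd.fst

/-! #### The guess for a given selection -/

theorem exists_heaviest_subset {ι : Type} [DecidableEq ι] (f : ι → ℚ) (S : Finset ι) {m : ℕ}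
    (hm : m ≤ S.card) : ∃ H ⊆ S, H.card = m ∧ ∀ i ∈ H, ∀ j ∈ S \ H, f j ≤ f i := by
  induction m with
  | zero => exact ⟨∅, by simp⟩
  | succ m ih =>
    obtain ⟨H, h1, h2, h3⟩ := ih (by omega)
    have hne : (S \ H).Nonempty := by
      rw [← Finset.card_pos, Finset.card_sdiff_of_subset h1]
      omega
    obtain ⟨x, hx, hmax⟩ := Finset.exists_max_image (S \ H) f hne
    rw [Finset.mem_sdiff] at hx
    refine ⟨insert x H, Finset.insert_subset hx.1 h1, ?_, fun i hi j hj => ?_⟩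
    · rw [Finset.card_insert_of_notMem hx.2, h2]
    · simp only [Finset.mem_sdiff, Finset.mem_insert, not_or] at hj
      rcases Finset.mem_insert.1 hi with rfl | hi
      · exact hmax j (by simp [hj.1, hj.2.2])
      · exact h3 i hi j (by simp [hj.1, hj.2.2])

/-- Here `r k` is a least profitable item among the `m` heaviest ones in dimension `k`, `G` consists
of the other heavy items and `Q` of the rest. Discarding the items `r k` is cheap by averaging, and
it leaves a gap in dimension `k` at least as large as the `k`-th weight of any item of `Q`. -/
theorem exists_guess {ι : Type} [DecidableEq ι] {m : ℕ} (w : ι → Fin D → ℚ) (p : ι → ℚ)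
    (hp : ∀ i, 0 ≤ p i) (S : Finset ι) (hm : 0 < m) (hmS : m ≤ S.card) :
    ∃ (G Q : Finset ι) (r : Fin D → ι), G ⊆ S ∧ Q ⊆ S ∧ Disjoint G Q ∧ G.card ≤ m * D ∧
      (∀ k, r k ∈ S ∧ r k ∉ G ∧ r k ∉ Q) ∧ (∀ k, ∀ i ∈ Q, w i k ≤ w (r k) k) ∧
      m * ∑ i ∈ S, p i ≤ m * (∑ i ∈ G, p i + ∑ i ∈ Q, p i) + D * ∑ i ∈ S, p i := by
  choose H hHS hHc hH using fun k : Fin D => exists_heaviest_subset (fun i => w i k) S hmS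
  have hr : ∀ k, ∃ i ∈ H k, ∀ j ∈ H k, p i ≤ p j := fun k =>
    Finset.exists_min_image (H k) p (Finset.card_pos.1 (by rw [hHc]; exact hm))
  choose r hrH hrmin using hr
  set U := Finset.univ.biUnion H with hU
  set R := Finset.univ.image r with hR
  have hUS : U ⊆ S := Finset.biUnion_subset.2 fun k _ => hHS k
  have hRU : R ⊆ U := by
    intro i hi
    obtain ⟨k, -, rfl⟩ := Finset.mem_image.1 hi
    exact Finset.mem_biUnion.2 ⟨k, Finset.mem_univ _, hrH k⟩
  have hrR : ∀ k, r k ∈ R := fun k => Finset.mem_image_of_mem r (Finset.mem_univ k)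
  refine ⟨U \ R, S \ U, r, Finset.sdiff_subset.trans hUS, Finset.sdiff_subset, ?_, ?_,
    fun k => ⟨hUS (hRU (hrR k)), ?_, ?_⟩, fun k i hi => hH k _ (hrH k) i ?_, ?_⟩
  · exact Finset.disjoint_sdiff.mono_left Finset.sdiff_subset
  · refine (Finset.card_le_card Finset.sdiff_subset).trans (Finset.card_biUnion_le.trans ?_)
    simp [hHc, mul_comm]
  · simp [hrR k]
  · simp [hRU (hrR k)]
  · rw [Finset.mem_sdiff] at hi ⊢
    exact ⟨hi.1, fun h => hi.2 (Finset.mem_biUnion.2 ⟨k, Finset.mem_univ _, h⟩)⟩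
  · have e1 := Finset.sum_sdiff (f := p) hUS
    have e2 := Finset.sum_sdiff (f := p) hRU
    -- Only an inequality, since one item may be discarded for several dimensions.
    have h1 : ∑ i ∈ R, p i ≤ ∑ k, p (r k) := Finset.sum_image_le_of_nonneg fun i _ => hp i
    have h2 : ∀ k, m * p (r k) ≤ ∑ i ∈ S, p i := fun k =>
      calc (m : ℚ) * p (r k) = ∑ i ∈ H k, p (r k) := by rw [Finset.sum_const, hHc, nsmul_eq_mul]
        _ ≤ ∑ i ∈ H k, p i := Finset.sum_le_sum (hrmin k)
        _ ≤ _ := Finset.sum_le_sum_of_subset_of_nonneg (hHS k) fun i _ _ => hp i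
    have h3 : m * ∑ k, p (r k) ≤ D * ∑ i ∈ S, p i := by
      rw [Finset.mul_sum]
      refine (Finset.sum_le_sum fun k _ => h2 k).trans ?_
      simp
    have hm' : (0 : ℚ) < m := by exact_mod_cast hm
    nlinarith

end VectorKnapsack

/-! ### Correctness and ratio of the vector knapsack scheme -/

section Schemes

theorem PolyTime.exists_polynomial {α β : Type} [Enc α] [Enc β] {f : α → β} (hf : PolyTime f) :
    ∃ (c : RCode) (P : Polynomial ℕ), ∀ a, ∃ t, c.Runs (enc a) (enc (f a)) t ∧
      t ≤ P.eval (enc a).size := by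
  obtain ⟨c, T, ⟨k, hT⟩, h⟩ := hf
  refine ⟨c, (Polynomial.X + 2) ^ k, fun a => ?_⟩
  obtain ⟨t, ht, hr⟩ := h a
  refine ⟨t, hr, (ht.trans (hT a)).trans ?_⟩
  simp [sz]

variable {D : ℕ}

theorem VKSInstance.encode_eq (I : VKSInstance D) :
    I.encode = enc (List.ofFn fun i => (I.profit i, I.wt i)) := by
  rw [VKSInstance.encode]
  simp only [enc, List.map_ofFn]
  rfl

theorem encodeSelection_eq {n : ℕ} (l : List (Fin n)) :
    encodeSelection l = enc (l.map fun i : Fin n => (i : ℕ)) := by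
  simp only [encodeSelection, enc, List.map_map]
  rfl

/-- The item `i` together with its number. -/
def VKSInstance.item (I : VKSInstance D) (i : Fin I.n) : VItem D := ((i : ℕ), I.profit i, I.wt i)

/-- The numbered items. -/
def VKSInstance.items (I : VKSInstance D) : List (VItem D) :=
  numbered (List.ofFn fun i => (I.profit i, I.wt i)).reverse

namespace VKSInstance

variable (I : VKSInstance D)

theorem item_injective : Function.Injective I.item := fun _ _ h =>
  Fin.ext (congrArg Prod.fst h)

theorem mem_items {x : VItem D} : x ∈ I.items ↔ ∃ i, x = I.item i := mem_numbered_ofFn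

theorem length_items : I.items.length = I.n := by
  rw [items, length_numbered]
  simp

theorem nodup_map_fst_items : (I.items.map Prod.fst).Nodup := by
  rw [items, map_fst_numbered]
  simp [List.nodup_range]

theorem nodup_items : I.items.Nodup := I.nodup_map_fst_items.of_map _

theorem sum_map_item {l : List (Fin I.n)} (hl : l.Nodup) (f : VItem D → ℚ) :
    ((l.map I.item).map f).sum = ∑ i ∈ l.toFinset, f (I.item i) := by
  rw [List.sum_toFinset _ hl, List.map_map]
  rfl

theorem sum_map_toList_item (S : Finset (Fin I.n)) (f : VItem D → ℚ) :
    ((S.toList.map I.item).map f).sum = ∑ i ∈ S, f (I.item i) := by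
  rw [I.sum_map_item S.nodup_toList, Finset.toList_toFinset]

theorem nodup_map_fst_map_item {l : List (Fin I.n)} :
    ((l.map I.item).map Prod.fst).Nodup ↔ l.Nodup := by
  rw [List.map_map]
  exact List.nodup_map_iff fun _ _ h => Fin.ext h

theorem exists_map_item {T : List (VItem D)} (hT : ∀ x ∈ T, x ∈ I.items)
    (hn : (T.map Prod.fst).Nodup) : ∃ l : List (Fin I.n), T = l.map I.item ∧ l.Nodup := by
  have : T ∈ Set.range (List.map I.item) := by
    rw [Set.range_list_map]
    intro x hx
    obtain ⟨i, rfl⟩ := I.mem_items.1 (hT x hx)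
    exact ⟨i, rfl⟩
  obtain ⟨l, rfl⟩ := this
  exact ⟨l, rfl, I.nodup_map_fst_map_item.1 hn⟩

theorem mem_candidates {K : ℕ} {T : List (VItem D)} (hT : T ∈ candidates K I.items) :
    (∀ x ∈ T, x ∈ I.items) ∧ (T.map Prod.fst).Nodup := by
  obtain ⟨g, hg, hT⟩ := List.mem_flatMap.1 hT
  have hgL : ∀ x ∈ distinctNumbers g, x ∈ I.items := fun x hx =>
    (mem_boundedLists.1 hg).2 x ((distinctNumbers_sublist g).subset hx)
  rcases List.mem_cons.1 hT with rfl | hT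
  · exact ⟨hgL, nodup_map_fst_distinctNumbers g⟩
  · obtain ⟨r, -, hT⟩ := List.mem_flatMap.1 hT
    obtain ⟨U, hU, rfl⟩ := List.mem_map.1 hT
    have hUs := sublist_of_mem_bestSelections _ _ hU
    refine ⟨fun x hx => ?_, ?_⟩
    · rcases List.mem_append.1 hx with hx | hx
      · exact hgL x hx
      · exact List.mem_of_mem_filter (hUs.subset hx)
    · rw [List.map_append, List.nodup_append']
      refine ⟨nodup_map_fst_distinctNumbers g, I.nodup_map_fst_items.sublist
        ((hUs.trans List.filter_sublist).map _), ?_⟩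
      intro j hj hj'
      obtain ⟨y, hy, rfl⟩ := List.mem_map.1 hj
      obtain ⟨x, hx, hxy⟩ := List.mem_map.1 hj'
      have := hUs.subset hx
      simp only [lightItems, List.mem_filter, decide_eq_true_eq] at this
      exact this.2.1 ⟨y, hy, hxy.symm⟩

/-- The right guess is among those enumerated. For it, the table entry `T` with the key of `Q` is at
least as profitable as `Q`, and it exceeds the weights of `Q` by no more than the gaps left by the
discarded items. The bound `m * D + m` leaves room both for `G` and for a whole set of fewer than
`m` items. -/
theorem exists_candidate {m : ℕ} (hm : 0 < m) {S : Finset (Fin I.n)} (hS : I.Feasible S) :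
    ∃ T ∈ candidates (m * D + m) I.items, (∀ k, (T.map fun x => x.2.2 k).sum ≤ 1) ∧
      m * ∑ i ∈ S, I.profit i ≤ m * profitSum T + D * ∑ i ∈ S, I.profit i := by
  have hpS : 0 ≤ ∑ i ∈ S, I.profit i := Finset.sum_nonneg fun i _ => I.profit_nonneg i
  have hguess : ∀ G : Finset (Fin I.n), G.card ≤ m * D + m →
      G.toList.map I.item ∈ boundedLists (m * D + m) I.items ∧
      distinctNumbers (G.toList.map I.item) = G.toList.map I.item := by
    intro G hG
    refine ⟨mem_boundedLists.2 ⟨by simpa using hG, fun x hx => ?_⟩,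
      distinctNumbers_eq_self (I.nodup_map_fst_map_item.2 G.nodup_toList)⟩
    obtain ⟨i, -, rfl⟩ := List.mem_map.1 hx
    exact I.mem_items.2 ⟨i, rfl⟩
  -- A set of fewer than `m` items is guessed completely, without any loss.
  rcases lt_or_ge S.card m with hlt | hge
  · obtain ⟨h1, h2⟩ := hguess S (by omega)
    refine ⟨S.toList.map I.item, List.mem_flatMap.2 ⟨_, h1, ?_⟩, fun k => ?_, ?_⟩
    · rw [h2]
      simp
    · rw [I.sum_map_toList_item]
      exact hS k
    · rw [profitSum, I.sum_map_toList_item]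
      simp only [item]
      have : 0 ≤ (D : ℚ) * ∑ i ∈ S, I.profit i := by positivity
      linarith
  · obtain ⟨G, Q, r, hGS, hQS, hGQ, hGc, hr, hwr, hprofit⟩ :=
      exists_guess I.wt I.profit I.profit_nonneg S hm hge
    obtain ⟨h1, h2⟩ := hguess G (by omega)
    set μ : Fin D → ℚ := fun k => I.wt (r k) k with hμ
    set light := lightItems I.items (G.toList.map I.item) μ with hlight
    have hlw : ∀ k, ∀ x ∈ light, 0 ≤ x.2.2 k ∧ x.2.2 k ≤ μ k := fun k x hx => by
      simp only [hlight, lightItems, List.mem_filter, decide_eq_true_eq] at hx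
      exact hx.2.2 k
    -- The items of `Q` in the order of the list of light items, because the dynamic program speaks
    -- about sublists.
    set q := light.filter fun x => ∃ i ∈ Q, x = I.item i with hq
    have hqQ : q.Perm (Q.toList.map I.item) := by
      have hqn : q.Nodup := (I.nodup_items.filter _).filter _
      rw [List.perm_ext_iff_of_nodup hqn
        (Q.nodup_toList.map I.item_injective)]
      intro x
      simp only [hq, hlight, lightItems, List.mem_filter, decide_eq_true_eq, List.mem_map,
        Finset.mem_toList, I.mem_items]
      constructor
      · rintro ⟨-, i, hi, rfl⟩
        exact ⟨i, hi, rfl⟩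
      · rintro ⟨i, hi, rfl⟩
        refine ⟨⟨⟨i, rfl⟩, ?_, fun k => ⟨I.wt_nonneg i k, hwr k i hi⟩⟩, i, hi, rfl⟩
        rintro ⟨y, ⟨j, hj, rfl⟩, hji⟩
        have : j = i := Fin.ext hji
        exact Finset.disjoint_left.1 hGQ hj (this ▸ hi)
    have hqsum : ∀ f : VItem D → ℚ, (q.map f).sum = ∑ i ∈ Q, f (I.item i) := fun f => by
      rw [(hqQ.map f).sum_eq, I.sum_map_toList_item]
    obtain ⟨T, hT, hTkey, hTp⟩ := exists_mem_bestSelections (roundedWeight I.items.length μ)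
      profitSum (fun x T T' h => by
        funext k
        have := congrFun h k
        simp only [roundedWeight, List.map_cons, List.sum_cons] at this ⊢
        rw [this]) (fun x T T' h => by
        simp only [profitSum, List.map_cons, List.sum_cons] at h ⊢
        linarith) (List.filter_sublist : q.Sublist light)
    have hTs := sublist_of_mem_bestSelections _ _ hT
    refine ⟨G.toList.map I.item ++ T, List.mem_flatMap.2 ⟨_, h1, List.mem_cons_of_mem _
      (List.mem_flatMap.2 ⟨fun k => I.item (r k), mem_tuples.2 fun k => I.mem_items.2 ⟨_, rfl⟩,
        List.mem_map.2 ⟨T, ?_, by rw [h2]⟩⟩)⟩, fun k => ?_, ?_⟩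
    · rw [h2]
      exact hT
    · obtain ⟨hrS, hrG, hrQ⟩ := hr k
      have hN : 0 < I.items.length := by
        rw [length_items]
        exact (r k).pos
      have b1 := (roundedWeight_bounds hN fun x hx => hlw k x
        (List.filter_sublist.subset hx : x ∈ light) : _ ∧ (q.map fun x => x.2.2 k).sum ≤ _).1
      have b2 := (roundedWeight_bounds hN fun x hx => hlw k x (hTs.subset hx)).2
      rw [hTkey] at b2
      rw [hqsum] at b1
      -- The total rounding error is at most the weight of the discarded item `r k`, as `T` has at
      -- most `I.items.length` items.
      have hTl : (T.length : ℚ) * (μ k / I.items.length) ≤ μ k := by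
        have hl : (T.length : ℚ) ≤ I.items.length := by
          exact_mod_cast hTs.length_le.trans (List.length_filter_le _ _)
        have hN' : (0 : ℚ) < I.items.length := by exact_mod_cast hN
        have hμ0 : 0 ≤ μ k / I.items.length := div_nonneg (I.wt_nonneg _ _) hN'.le
        calc (T.length : ℚ) * (μ k / I.items.length)
            ≤ I.items.length * (μ k / I.items.length) := mul_le_mul_of_nonneg_right hl hμ0
          _ = μ k := by field_simp
      have hsum : ∑ i ∈ G, I.wt i k + ∑ i ∈ Q, I.wt i k + I.wt (r k) k ≤ 1 := by
        refine le_trans ?_ (hS k)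
        rw [← Finset.sum_union hGQ, add_comm, ← Finset.sum_insert (f := fun i => I.wt i k)
          (show r k ∉ G ∪ Q by simp [hrG, hrQ])]
        refine Finset.sum_le_sum_of_subset_of_nonneg ?_ fun i _ _ => I.wt_nonneg i k
        exact Finset.insert_subset hrS (Finset.union_subset hGS hQS)
      rw [List.map_append, List.sum_append, I.sum_map_toList_item]
      simp only [item] at b1 ⊢
      linarith
    · have hTp' : ∑ i ∈ Q, I.profit i ≤ (T.map fun x => x.2.1).sum := by
        rw [profitSum, hqsum] at hTp
        exact hTp
      rw [profitSum, List.map_append, List.sum_append, I.sum_map_toList_item]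
      simp only [item]
      have hm' : (0 : ℚ) < m := by exact_mod_cast hm
      nlinarith

theorem approxKnapsack_spec {m : ℕ} (hm : 0 < m) :
    ∃ l : List (Fin I.n),
      approxKnapsack (m * D + m) (List.ofFn fun i => (I.profit i, I.wt i)) =
        l.map (fun i : Fin I.n => (i : ℕ)) ∧
      l.Nodup ∧ I.Feasible l.toFinset ∧ ∀ S : Finset (Fin I.n), I.Feasible S →
        m * ∑ i ∈ S, I.profit i ≤
          m * ∑ i ∈ l.toFinset, I.profit i + D * ∑ i ∈ S, I.profit i := by
  set C := (candidates (m * D + m) I.items).filter fun T =>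
    ∀ k, (T.map fun x => x.2.2 k).sum ≤ 1 with hC
  set b := best profitSum [] C with hb
  have hbprop : ((∀ x ∈ b, x ∈ I.items) ∧ (b.map Prod.fst).Nodup) ∧
      ∀ k, (b.map fun x => x.2.2 k).sum ≤ 1 := by
    rcases List.mem_cons.1 (best_mem profitSum [] C) with h | h
    · rw [hb, h]
      simp
    · rw [← hb, hC, List.mem_filter, decide_eq_true_eq] at h
      exact ⟨I.mem_candidates h.1, h.2⟩
  obtain ⟨l, hl, hnd⟩ := I.exists_map_item hbprop.1.1 hbprop.1.2
  refine ⟨l, ?_, hnd, fun k => ?_, fun S hS => ?_⟩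
  · change b.map (fun x => x.1) = _
    rw [hl, List.map_map]
    rfl
  · have := hbprop.2 k
    rw [hl, I.sum_map_item hnd] at this
    exact this
  · obtain ⟨T, hT, hTf, hTp⟩ := I.exists_candidate hm hS
    have h1 : profitSum T ≤ profitSum b := le_best profitSum [] C T
      (List.mem_cons_of_mem _ (List.mem_filter.2 ⟨hT, by simpa using hTf⟩))
    have h2 : profitSum b = ∑ i ∈ l.toFinset, I.profit i := by
      rw [hl, profitSum, I.sum_map_item hnd]
      rfl
    rw [← h2]
    have hm' : (0 : ℚ) < m := by exact_mod_cast hm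
    nlinarith

end VKSInstance

theorem exists_isVKSApprox (D : ℕ) {ε : ℝ} (hε : 0 < ε) : ∃ A, IsVKSApprox D (1 + ε) A := by
  -- This choice amounts to `1 - D / m > 1 / (1 + ε)`, where `D / m` is the fraction of the profit
  -- that is lost.
  obtain ⟨m, hm⟩ := exists_nat_gt (D * (1 + ε) / ε)
  rw [div_lt_iff₀ hε] at hm
  have hm0 : 0 < m := by
    rcases Nat.eq_zero_or_pos m with rfl | h
    · have : 0 ≤ (D : ℝ) * (1 + ε) := by positivity
      simp only [CharP.cast_eq_zero, zero_mul] at hm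
      linarith
    · exact h
  obtain ⟨c, P, h⟩ := (PolyTime.approxKnapsack (D := D) (m * D + m)).exists_polynomial
  refine ⟨c, P, fun I => ?_⟩
  obtain ⟨t, hr, ht⟩ := h (List.ofFn fun i => (I.profit i, I.wt i))
  obtain ⟨l, hl, hnd, hf, hopt⟩ := I.approxKnapsack_spec hm0
  rw [hl, ← encodeSelection_eq] at hr
  rw [← I.encode_eq] at hr ht
  refine ⟨_, t, hr, ht, l, rfl, hnd, hf, fun S hS => ?_⟩
  have h1 := hopt S hS
  have h2 : 0 ≤ ∑ i ∈ S, I.profit i := Finset.sum_nonneg fun i _ => I.profit_nonneg i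
  generalize ∑ i ∈ S, I.profit i = x at h1 h2 ⊢
  generalize ∑ i ∈ l.toFinset, I.profit i = y at h1 ⊢
  have h1' : (m : ℝ) * x ≤ m * y + D * x := by exact_mod_cast h1
  have h2' : (0 : ℝ) ≤ x := by exact_mod_cast h2
  have hm' : (0 : ℝ) < m := by exact_mod_cast hm0
  have h3 : (m : ℝ) * x ≤ m * ((1 + ε) * y) := by nlinarith
  exact le_of_mul_le_mul_left h3 hm'

end Schemes

/-! ### Shelf packing -/

section Shelves

variable {α β : Type}

/-- Stack objects of heights `h`, the last one at the bottom, and list their offsets. -/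
def stacked (h : β → ℚ) : List β → List (ℚ × β)
  | [] => []
  | x :: l => ((l.map h).sum, x) :: stacked h l

/-- Insertion into a list sorted by `h`. -/
def insertBy (h : β → ℚ) (x : β) (l : List β) : List β :=
  (l.filter fun y => h y < h x) ++ x :: l.filter fun y => ¬ h y < h x

/-- Sort a list by increasing `h`. -/
def sortBy (h : β → ℚ) (l : List β) : List β := l.foldr (insertBy h) []

/-- Add an object of width `wd x` to the current shelf, or to a new one if it does not fit. -/
def addToShelves (wd : β → ℚ) (x : β) : List (List β) → List (List β)
  | [] => [[x]]
  | s :: ss => if (s.map wd).sum + wd x ≤ 1 then (x :: s) :: ss else [x] :: s :: ss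

/-- Distribute objects of widths `wd` over shelves of width 1, starting with the last object. -/
def shelves (wd : β → ℚ) (l : List β) : List (List β) := l.foldr (addToShelves wd) []

/-- The largest height of the objects on a shelf. -/
def shelfHeight (h : β → ℚ) (s : List β) : ℚ := s.foldr (fun x m => if m ≤ h x then h x else m) 0

/-- The elements at even positions and the elements at odd positions. -/
def alternate (l : List β) : List β × List β := l.foldr (fun x p => (x :: p.2, p.1)) ([], [])

theorem insertBy_perm (h : β → ℚ) (x : β) (l : List β) : (insertBy h x l).Perm (x :: l) :=
  List.perm_middle.trans (.cons x (by
    simp only [decide_not]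
    exact List.filter_append_perm (fun y => decide (h y < h x)) l))

theorem sortBy_perm (h : β → ℚ) (l : List β) : (sortBy h l).Perm l := by
  induction l with
  | nil => exact .nil
  | cons x l ih => exact (insertBy_perm h x _).trans (ih.cons x)

theorem pairwise_sortBy (h : β → ℚ) (l : List β) :
    (sortBy h l).Pairwise fun x y => h x ≤ h y := by
  induction l with
  | nil => exact .nil
  | cons x l ih =>
    change ((_ : List β) ++ x :: _).Pairwise _
    rw [List.pairwise_append, List.pairwise_cons]
    refine ⟨ih.sublist List.filter_sublist, ⟨fun y hy => ?_, ih.sublist List.filter_sublist⟩,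
      fun y hy z hz => ?_⟩
    · simpa using (List.mem_filter.1 hy).2
    · have hyx : h y < h x := by simpa using (List.mem_filter.1 hy).2
      rcases List.mem_cons.1 hz with rfl | hz
      · exact hyx.le
      · have hxz : h x ≤ h z := by simpa using (List.mem_filter.1 hz).2
        exact hyx.le.trans hxz

theorem shelfHeight_cons (h : β → ℚ) (x : β) (s : List β) :
    shelfHeight h (x :: s) = max (h x) (shelfHeight h s) := by
  change (if shelfHeight h s ≤ h x then h x else shelfHeight h s) = _
  split_ifs with hx
  · exact (max_eq_left hx).symm
  · exact (max_eq_right (not_le.1 hx).le).symm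

theorem shelfHeight_nonneg (h : β → ℚ) (s : List β) : 0 ≤ shelfHeight h s := by
  induction s with
  | nil => exact le_rfl
  | cons x s ih =>
    rw [shelfHeight_cons]
    exact ih.trans (le_max_right _ _)

theorem le_shelfHeight (h : β → ℚ) {s : List β} {x : β} (hx : x ∈ s) : h x ≤ shelfHeight h s := by
  induction s with
  | nil => simp at hx
  | cons y s ih =>
    rw [shelfHeight_cons]
    rcases List.mem_cons.1 hx with rfl | hx
    · exact le_max_left _ _
    · exact (ih hx).trans (le_max_right _ _)

theorem shelfHeight_le (h : β → ℚ) {s : List β} {b : ℚ} (hb : 0 ≤ b) (hs : ∀ x ∈ s, h x ≤ b) :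
    shelfHeight h s ≤ b := by
  induction s with
  | nil => exact hb
  | cons y s ih =>
    rw [shelfHeight_cons]
    exact max_le (hs y (by simp)) (ih fun x hx => hs x (by simp [hx]))

theorem alternate_cons (x : β) (l : List β) :
    alternate (x :: l) = (x :: (alternate l).2, (alternate l).1) := rfl

theorem alternate_perm (l : List β) : ((alternate l).1 ++ (alternate l).2).Perm l := by
  induction l with
  | nil => exact .nil
  | cons x l ih => exact (List.perm_append_comm.trans ih).cons x

theorem flatten_shelves (wd : β → ℚ) (l : List β) : (shelves wd l).flatten = l := by
  induction l with
  | nil => rfl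
  | cons x l ih =>
    change (addToShelves wd x (shelves wd l)).flatten = _
    cases h : shelves wd l with
    | nil =>
      rw [h] at ih
      rw [← ih]
      rfl
    | cons s ss =>
      rw [h] at ih
      rw [← ih, addToShelves]
      split_ifs <;> simp

theorem sum_map_mul_ge {wd h : β → ℚ} {s : List β} {b : ℚ} (hw : ∀ x ∈ s, 0 ≤ wd x)
    (hb : ∀ x ∈ s, b ≤ h x) : b * (s.map wd).sum ≤ (s.map fun x => h x * wd x).sum := by
  induction s with
  | nil => simp
  | cons x s ih =>
    have h1 := ih (fun y hy => hw y (by simp [hy])) fun y hy => hb y (by simp [hy])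
    have h2 := mul_le_mul_of_nonneg_right (hb x (by simp)) (hw x (by simp))
    simp only [List.map_cons, List.sum_cons, mul_add]
    linarith

/-- Every shelf is filled up to width at most 1, and the height of a shelf is at most its area plus
the area of the shelf opened before it. -/
theorem shelves_spec {wd h : β → ℚ} {l : List β} (hw : ∀ x ∈ l, 0 ≤ wd x ∧ wd x ≤ 1)
    (hh : ∀ x ∈ l, 0 ≤ h x) (hl : l.Pairwise fun x y => h x ≤ h y) :
    (∀ s ∈ shelves wd l, s ≠ [] ∧ (s.map wd).sum ≤ 1) ∧
    (shelves wd l).IsChain fun s' s => shelfHeight h s' ≤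
      (s.map fun x => h x * wd x).sum + (s'.map fun x => h x * wd x).sum := by
  induction l with
  | nil => simp [shelves]
  | cons x l ih =>
    rw [List.pairwise_cons] at hl
    obtain ⟨ih1, ih2⟩ := ih (fun y hy => hw y (by simp [hy])) (fun y hy => hh y (by simp [hy])) hl.2
    have hmem : ∀ s ∈ shelves wd l, ∀ y ∈ s, y ∈ l := fun s hs y hy => by
      rw [← flatten_shelves wd l]
      exact List.mem_flatten.2 ⟨s, hs, hy⟩
    change (∀ s ∈ addToShelves wd x (shelves wd l), _) ∧
      (addToShelves wd x (shelves wd l)).IsChain _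
    obtain ⟨hx0, hx1⟩ := hw x (by simp)
    have hhx := hh x (by simp)
    cases hs : shelves wd l with
    | nil => simp [addToShelves, hx1]
    | cons s ss =>
      rw [hs] at ih1 ih2 hmem
      rw [addToShelves]
      split_ifs with hfit
      · constructor
        · intro t ht
          rcases List.mem_cons.1 ht with rfl | ht
          · refine ⟨by simp, ?_⟩
            rw [List.map_cons, List.sum_cons]
            linarith
          · exact ih1 t (by simp [ht])
        · cases ss with
          | nil => simp
          | cons t ss =>
            rw [List.isChain_cons_cons] at ih2 ⊢
            refine ⟨?_, ih2.2⟩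
            obtain ⟨y, hy⟩ := List.exists_mem_of_ne_nil s (ih1 s (by simp)).1
            -- Boxes arrive by decreasing height, so `x` does not raise the shelf and only adds area
            -- to it.
            have h1 : h x ≤ shelfHeight h s :=
              (hl.1 y (hmem s (by simp) y hy)).trans (le_shelfHeight h hy)
            rw [shelfHeight_cons, max_eq_right h1, List.map_cons, List.sum_cons]
            have := mul_nonneg hhx hx0
            linarith [ih2.1]
      · constructor
        · intro t ht
          rcases List.mem_cons.1 ht with rfl | ht
          · simpa using hx1
          · exact ih1 t ht
        · rw [List.isChain_cons_cons]
          refine ⟨?_, ih2⟩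
          -- The widths on `s` together with that of `x` exceed 1 and all heights involved are at
          -- least `h x`, so the areas of `s` and of `x` add up to at least `h x`.
          have h1 := sum_map_mul_ge (wd := wd) (h := h) (s := s) (b := h x)
            (fun y hy => (hw y (by simp [hmem s (by simp) y hy])).1)
            fun y hy => hl.1 y (hmem s (by simp) y hy)
          have h2 := mul_le_mul_of_nonneg_left (not_le.1 hfit).le hhx
          have h3 : shelfHeight h [x] ≤ h x := shelfHeight_le h hhx (by simp)
          simp only [List.map_cons, List.map_nil, List.sum_cons, List.sum_nil]
          linarith

/-- Each height is charged to the areas of its own shelf and of the preceding one. Among every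
second shelf these pairs are disjoint, so no area is used twice. -/
theorem alternate_sum_le {H V : β → ℚ} (s : β) (l : List β)
    (hV : ∀ x ∈ s :: l, 0 ≤ V x) (hl : (s :: l).IsChain fun s s' => H s' ≤ V s + V s') :
    ((alternate l).1.map H).sum ≤ V s + (l.map V).sum ∧
      ((alternate l).2.map H).sum ≤ (l.map V).sum := by
  induction l generalizing s with
  | nil => simpa [alternate] using hV
  | cons t l ih =>
    rw [List.isChain_cons_cons] at hl
    obtain ⟨h1, h2⟩ := ih t (fun x hx => hV x (by simp [List.mem_cons.1 hx])) hl.2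
    rw [alternate_cons]
    simp only [List.map_cons, List.sum_cons]
    constructor <;> linarith [hl.1]

/-! ### Packing boxes -/

/-- Pack every shelf by `pk`, and stack the shelves along a new first axis; the bins used are those
whose number is congruent to `c` modulo 3. -/
def placeShelves {d : ℕ} (pk : List (α × (Fin d → ℚ)) → List (α × ℕ × (Fin d → ℚ))) (c : ℕ)
    (ss : List (List (α × (Fin (d + 1) → ℚ)))) : List (α × ℕ × (Fin (d + 1) → ℚ)) :=
  (stacked (shelfHeight fun x => x.2 0) ss).flatMap fun e =>
    (pk (e.2.map fun x => (x.1, fun j => x.2 j.succ))).map fun q =>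
      (q.1, 3 * q.2.1 + c, Fin.cons e.1 q.2.2)

/-- Distribute boxes of total volume at most 1 over `3 ^ d` unit bins of dimension `d + 1`: every
box gets a bin number and a position. -/
def packBoxes : (d : ℕ) → List (α × (Fin (d + 1) → ℚ)) → List (α × ℕ × (Fin (d + 1) → ℚ))
  | 0, l => (stacked (fun x => x.2 0) l).map fun e => (e.2.1, 0, fun _ => e.1)
  | d + 1, l =>
    match (shelves (fun x => ∏ j : Fin (d + 1), x.2 j.succ)
        (sortBy (fun x => x.2 0) l)).reverse with
    | [] => []
    | s :: ss => placeShelves (packBoxes d) 0 [s] ++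
        (placeShelves (packBoxes d) 1 (alternate ss).1 ++
          placeShelves (packBoxes d) 2 (alternate ss).2)

/-- Boxes of side lengths `len` placed in `b` unit bins without overlap. -/
structure IsBinPacking {d : ℕ} (len : α → Fin d → ℚ) (b : ℕ) (E : List (α × ℕ × (Fin d → ℚ))) :
    Prop where
  bin_lt : ∀ e ∈ E, e.2.1 < b
  inside : ∀ e ∈ E, ∀ j, 0 ≤ e.2.2 j ∧ e.2.2 j + len e.1 j ≤ 1
  apart : E.Pairwise fun e e' => e.2.1 = e'.2.1 → ∃ j,
    e.2.2 j + len e.1 j ≤ e'.2.2 j ∨ e'.2.2 j + len e'.1 j ≤ e.2.2 j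

theorem map_snd_stacked (h : β → ℚ) (l : List β) : (stacked h l).map Prod.snd = l := by
  induction l with
  | nil => rfl
  | cons x l ih => rw [stacked, List.map_cons, ih]

theorem placeShelves_cons {d : ℕ} (pk : List (α × (Fin d → ℚ)) → List (α × ℕ × (Fin d → ℚ)))
    (c : ℕ) (s : List (α × (Fin (d + 1) → ℚ))) (ss : List (List (α × (Fin (d + 1) → ℚ)))) :
    placeShelves pk c (s :: ss) =
      ((pk (s.map fun x => (x.1, fun j => x.2 j.succ))).map fun q =>
        (q.1, 3 * q.2.1 + c, Fin.cons (ss.map (shelfHeight fun x => x.2 0)).sum q.2.2)) ++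
      placeShelves pk c ss := rfl

/-- All shelves of a stack use the same bins. Boxes of one shelf are separated by the packing `pk`
in the remaining dimensions, boxes of different shelves along axis 0. The residue `c` modulo 3 keeps
the bins of different stacks distinct. -/
theorem placeShelves_spec {d : ℕ} {pk : List (α × (Fin d → ℚ)) → List (α × ℕ × (Fin d → ℚ))}
    {c b : ℕ} (hc : c < 3) {len : α → Fin (d + 1) → ℚ}
    {ss : List (List (α × (Fin (d + 1) → ℚ)))} (hlen : ∀ s ∈ ss, ∀ x ∈ s, x.2 = len x.1)
    (hpk : ∀ s ∈ ss, ((pk (s.map fun x => (x.1, fun j => x.2 j.succ))).map Prod.fst).Perm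
        (s.map Prod.fst) ∧
      IsBinPacking (fun t j => len t j.succ) b (pk (s.map fun x => (x.1, fun j => x.2 j.succ)))) :
    ((placeShelves pk c ss).map Prod.fst).Perm (ss.flatten.map Prod.fst) ∧
    (∀ e ∈ placeShelves pk c ss, e.2.1 < 3 * b ∧ e.2.1 % 3 = c ∧ 0 ≤ e.2.2 0 ∧
      e.2.2 0 + len e.1 0 ≤ (ss.map (shelfHeight fun x => x.2 0)).sum ∧
      ∀ j : Fin d, 0 ≤ e.2.2 j.succ ∧ e.2.2 j.succ + len e.1 j.succ ≤ 1) ∧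
    (placeShelves pk c ss).Pairwise fun e e' => e.2.1 = e'.2.1 → ∃ j,
      e.2.2 j + len e.1 j ≤ e'.2.2 j ∨ e'.2.2 j + len e'.1 j ≤ e.2.2 j := by
  induction ss with
  | nil => simp [placeShelves, stacked]
  | cons s ss ih =>
    obtain ⟨ih1, ih2, ih3⟩ := ih (fun t ht => hlen t (by simp [ht]))
      fun t ht => hpk t (by simp [ht])
    obtain ⟨p1, p2, p3, p4⟩ := hpk s (by simp)
    have hH : 0 ≤ (ss.map (shelfHeight fun x => x.2 0)).sum := by
      refine List.sum_nonneg fun x hx => ?_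
      obtain ⟨t, -, rfl⟩ := List.mem_map.1 hx
      exact shelfHeight_nonneg _ t
    have hHs := shelfHeight_nonneg (fun x : α × (Fin (d + 1) → ℚ) => x.2 0) s
    rw [placeShelves_cons]
    refine ⟨?_, fun e he => ?_, ?_⟩
    · rw [List.map_append, List.flatten_cons, List.map_append, List.map_map]
      exact p1.append ih1
    · rw [List.map_cons, List.sum_cons]
      rcases List.mem_append.1 he with he | he
      · obtain ⟨q, hq, rfl⟩ := List.mem_map.1 he
        have hq1 := p2 q hq
        have hmem : q.1 ∈ s.map Prod.fst := p1.subset (List.mem_map_of_mem (f := Prod.fst) hq)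
        obtain ⟨x, hx, hxq⟩ := List.mem_map.1 hmem
        have hle := le_shelfHeight (fun x : α × (Fin (d + 1) → ℚ) => x.2 0) hx
        simp only [hlen s (by simp) x hx, hxq] at hle
        refine ⟨by dsimp only; omega, by dsimp only; omega, by simpa using hH, ?_, fun j => ?_⟩
        · simp only [Fin.cons_zero]
          linarith
        · simpa using p3 q hq j
      · obtain ⟨h1, h2, h3, h4, h5⟩ := ih2 e he
        exact ⟨h1, h2, h3, by linarith, h5⟩
    · rw [List.pairwise_append, List.pairwise_map]
      refine ⟨p4.imp fun {q q'} h hqq => ?_, ih3, fun e he e' he' _ => ⟨0, Or.inr ?_⟩⟩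
      · obtain ⟨j, hj⟩ := h (by dsimp only at hqq; omega)
        exact ⟨j.succ, by simpa using hj⟩
      -- The last shelf lies at the bottom, so everything on `ss` ends below the offset of `s`.
      · obtain ⟨q, hq, rfl⟩ := List.mem_map.1 he
        simpa using (ih2 e' he').2.2.2.1

theorem stacked_one_dim_spec {len : α → Fin 1 → ℚ} {l : List (α × (Fin 1 → ℚ))}
    (hlen : ∀ x ∈ l, x.2 = len x.1) (h0 : ∀ x ∈ l, 0 ≤ len x.1 0) :
    (∀ e ∈ stacked (fun x => x.2 0) l, 0 ≤ e.1 ∧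
      e.1 + len e.2.1 0 ≤ (l.map fun x => x.2 0).sum) ∧
    (stacked (fun x => x.2 0) l).Pairwise fun e e' => e'.1 + len e'.2.1 0 ≤ e.1 := by
  induction l with
  | nil => simp [stacked]
  | cons x l ih =>
    obtain ⟨ih1, ih2⟩ := ih (fun y hy => hlen y (by simp [hy])) fun y hy => h0 y (by simp [hy])
    have hx := hlen x (by simp)
    have hx0 := h0 x (by simp)
    rw [stacked, List.pairwise_cons]
    refine ⟨fun e he => ?_, fun e he => (ih1 e he).2, ih2⟩
    rw [List.map_cons, List.sum_cons]
    rcases List.mem_cons.1 he with rfl | he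
    · refine ⟨List.sum_nonneg fun y hy => ?_, by rw [hx]; linarith⟩
      obtain ⟨z, hz, rfl⟩ := List.mem_map.1 hy
      rw [hlen z (by simp [hz])]
      exact h0 z (by simp [hz])
    · obtain ⟨h1, h2⟩ := ih1 e he
      exact ⟨h1, by rw [hx]; linarith⟩

/-- In dimension 1 volume is length and the intervals are laid end to end. In the induction step,
the width bound of a shelf is the volume bound for its boxes with side 0 removed. -/
theorem packBoxes_spec (d : ℕ) {len : α → Fin (d + 1) → ℚ} {l : List (α × (Fin (d + 1) → ℚ))}
    (hlen : ∀ x ∈ l, x.2 = len x.1) (h01 : ∀ x ∈ l, ∀ j, 0 ≤ x.2 j ∧ x.2 j ≤ 1)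
    (hvol : (l.map fun x => ∏ j, x.2 j).sum ≤ 1) :
    ((packBoxes d l).map Prod.fst).Perm (l.map Prod.fst) ∧
      IsBinPacking len (3 ^ d) (packBoxes d l) := by
  induction d with
  | zero =>
    obtain ⟨h1, h2⟩ := stacked_one_dim_spec hlen fun x hx => by
      rw [← hlen x hx]
      exact (h01 x hx 0).1
    refine ⟨?_, ⟨?_, ?_, ?_⟩⟩
    · rw [packBoxes, List.map_map]
      have := congrArg (List.map Prod.fst) (map_snd_stacked (fun x => x.2 0) l)
      rw [List.map_map] at this
      exact .of_eq this
    · intro e he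
      obtain ⟨q, -, rfl⟩ := List.mem_map.1 he
      simp
    · intro e he j
      obtain ⟨q, hq, rfl⟩ := List.mem_map.1 he
      have hvol' : (l.map fun x => x.2 0).sum ≤ 1 := by simpa using hvol
      obtain rfl : j = 0 := Fin.fin_one_eq_zero j
      exact ⟨(h1 q hq).1, (h1 q hq).2.trans hvol'⟩
    · rw [packBoxes, List.pairwise_map]
      exact h2.imp fun h _ => ⟨0, Or.inr h⟩
  | succ d ih =>
    set wd : α × (Fin (d + 2) → ℚ) → ℚ := fun x => ∏ j : Fin (d + 1), x.2 j.succ with hwd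
    set h : α × (Fin (d + 2) → ℚ) → ℚ := fun x => x.2 0 with hh
    set V : List (α × (Fin (d + 2) → ℚ)) → ℚ := fun s => (s.map fun x => h x * wd x).sum with hV
    have hvol' : V l ≤ 1 := by
      refine le_trans (le_of_eq ?_) hvol
      exact congrArg List.sum (List.map_congr_left fun x _ => (Fin.prod_univ_succ _).symm)
    have hperm := sortBy_perm h l
    have hw : ∀ x ∈ l, 0 ≤ wd x ∧ wd x ≤ 1 := fun x hx =>
      ⟨Finset.prod_nonneg fun j _ => (h01 x hx j.succ).1,
        Finset.prod_le_one (fun j _ => (h01 x hx j.succ).1) fun j _ => (h01 x hx j.succ).2⟩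
    obtain ⟨s1, s2⟩ := shelves_spec (wd := wd) (h := h) (l := sortBy h l)
      (fun x hx => hw x (hperm.subset hx)) (fun x hx => (h01 x (hperm.subset hx) 0).1)
      (pairwise_sortBy h l)
    have hflat : (shelves wd (sortBy h l)).reverse.flatten.Perm l := by
      refine ((List.reverse_perm _).flatten).trans ?_
      rw [flatten_shelves]
      exact hperm
    have hchain := List.isChain_reverse.2 s2
    have hmem' : ∀ s ∈ (shelves wd (sortBy h l)).reverse, ∀ x ∈ s, x ∈ l := fun s hs x hx =>
      hflat.subset (List.mem_flatten.2 ⟨s, hs, hx⟩)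
    have hVnn : ∀ s ∈ (shelves wd (sortBy h l)).reverse, 0 ≤ V s := fun s hs => by
      refine List.sum_nonneg fun y hy => ?_
      obtain ⟨x, hx, rfl⟩ := List.mem_map.1 hy
      have hxl := hmem' s hs x hx
      exact mul_nonneg (h01 x hxl 0).1 (hw x hxl).1
    have hVsum : ((shelves wd (sortBy h l)).reverse.map V).sum ≤ 1 := by
      refine le_trans (le_of_eq ?_) hvol'
      rw [hV]
      dsimp only
      rw [← (hflat.map _).sum_eq, List.map_flatten, List.sum_flatten, List.map_map]
      rfl
    rw [packBoxes]
    have hs1 : ∀ s ∈ (shelves wd (sortBy h l)).reverse, (s.map wd).sum ≤ 1 := fun s hs =>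
      (s1 s (List.mem_reverse.1 hs)).2
    change ((match (shelves wd (sortBy h l)).reverse with
      | [] => []
      | s :: ss => placeShelves (packBoxes d) 0 [s] ++
        (placeShelves (packBoxes d) 1 (alternate ss).1 ++
          placeShelves (packBoxes d) 2 (alternate ss).2)).map Prod.fst).Perm _ ∧
      IsBinPacking len _ (match (shelves wd (sortBy h l)).reverse with
      | [] => []
      | s :: ss => placeShelves (packBoxes d) 0 [s] ++
        (placeShelves (packBoxes d) 1 (alternate ss).1 ++
          placeShelves (packBoxes d) 2 (alternate ss).2))
    generalize (shelves wd (sortBy h l)).reverse = ss at *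
    cases ss with
    | nil =>
      obtain rfl : l = [] := hflat.symm.eq_nil
      exact ⟨.nil, ⟨by simp, by simp, by simp⟩⟩
    | cons s ss =>
      obtain ⟨a1, a2⟩ := alternate_sum_le (H := shelfHeight h) (V := V) s ss hVnn hchain
      -- Stated for any residue and any collection of shelves, so that it serves all three stacks.
      have hplace : ∀ c < 3, ∀ cs : List (List (α × (Fin (d + 2) → ℚ))),
          (∀ t ∈ cs, t ∈ s :: ss) → _ := fun c hc cs hcs =>
        placeShelves_spec (pk := packBoxes d) (b := 3 ^ d) (len := len) hc (ss := cs)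
          (fun t ht x hx => hlen x (hmem' t (hcs t ht) x hx)) fun t ht => by
            have := ih (len := fun t j => len t j.succ)
              (l := t.map fun x => (x.1, fun j => x.2 j.succ)) ?_ ?_ ?_
            · rw [List.map_map] at this
              exact this
            · intro y hy
              obtain ⟨x, hx, rfl⟩ := List.mem_map.1 hy
              simp only [hlen x (hmem' t (hcs t ht) x hx)]
            · intro y hy j
              obtain ⟨x, hx, rfl⟩ := List.mem_map.1 hy
              exact h01 x (hmem' t (hcs t ht) x hx) j.succ
            · rw [List.map_map]
              exact hs1 t (hcs t ht)
      have hp := alternate_perm ss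
      obtain ⟨x1, x2, x3⟩ := hplace 0 (by norm_num) [s] (by simp)
      obtain ⟨y1, y2, y3⟩ := hplace 1 (by norm_num) (alternate ss).1 fun t ht =>
        List.mem_cons_of_mem _ (hp.subset (List.mem_append_left _ ht))
      obtain ⟨z1, z2, z3⟩ := hplace 2 (by norm_num) (alternate ss).2 fun t ht =>
        List.mem_cons_of_mem _ (hp.subset (List.mem_append_right _ ht))
      have hV0 := hVnn s (by simp)
      rw [List.map_cons, List.sum_cons] at hVsum
      have b0 : ([s].map (shelfHeight h)).sum ≤ 1 := by
        simp only [List.map_cons, List.map_nil, List.sum_cons, List.sum_nil, add_zero]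
        exact shelfHeight_le h zero_le_one fun x hx => (h01 x (hmem' s (by simp) x hx) 0).2
      have b1 : ((alternate ss).1.map (shelfHeight h)).sum ≤ 1 := a1.trans hVsum
      have b2 : ((alternate ss).2.map (shelfHeight h)).sum ≤ 1 := by linarith
      dsimp only
      set E0 := placeShelves (packBoxes d) 0 [s]
      set E1 := placeShelves (packBoxes d) 1 (alternate ss).1
      set E2 := placeShelves (packBoxes d) 2 (alternate ss).2
      have hall : ∀ e ∈ E0 ++ (E1 ++ E2), e.2.1 < 3 ^ (d + 1) ∧
          ∀ j, 0 ≤ e.2.2 j ∧ e.2.2 j + len e.1 j ≤ 1 := by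
        have aux : ∀ (E : List (α × ℕ × (Fin (d + 2) → ℚ))) (c : ℕ) (H : ℚ), H ≤ 1 →
            (∀ e ∈ E, e.2.1 < 3 * 3 ^ d ∧ e.2.1 % 3 = c ∧ 0 ≤ e.2.2 0 ∧ e.2.2 0 + len e.1 0 ≤ H ∧
              ∀ j : Fin (d + 1), 0 ≤ e.2.2 j.succ ∧ e.2.2 j.succ + len e.1 j.succ ≤ 1) →
            ∀ e ∈ E, e.2.1 < 3 ^ (d + 1) ∧ ∀ j, 0 ≤ e.2.2 j ∧ e.2.2 j + len e.1 j ≤ 1 := by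
          intro E c H hH hE e he
          obtain ⟨h1, -, h2, h3, h4⟩ := hE e he
          exact ⟨by rw [pow_succ]; omega, fun j => Fin.cases ⟨h2, h3.trans hH⟩ h4 j⟩
        intro e he
        rcases List.mem_append.1 he with he | he
        · exact aux E0 0 _ b0 x2 e he
        · rcases List.mem_append.1 he with he | he
          · exact aux E1 1 _ b1 y2 e he
          · exact aux E2 2 _ b2 z2 e he
      refine ⟨?_, ⟨fun e he => (hall e he).1, fun e he => (hall e he).2, ?_⟩⟩
      · rw [List.map_append, List.map_append]
        refine (x1.append (y1.append z1)).trans ?_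
        rw [← List.map_append, ← List.map_append, ← List.flatten_append, ← List.flatten_append]
        exact ((hp.cons s).flatten.trans hflat).map _
      · rw [List.pairwise_append, List.pairwise_append]
        -- Boxes of different stacks never share a bin, as their bin numbers differ modulo 3.
        refine ⟨x3, ⟨y3, z3, fun e he e' he' hee => ?_⟩, fun e he e' he' hee => ?_⟩
        · have h1 := (y2 e he).2.1
          have h2 := (z2 e' he').2.1
          omega
        · have h1 := (x2 e he).2.1
          rcases List.mem_append.1 he' with he' | he'
          · have h2 := (y2 e' he').2.1
            omega
          · have h2 := (z2 e' he').2.1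
            omega

end Shelves

/-! ### Polynomial running time of the packing -/

section ShelvesPolyTime

variable {α β τ : Type} [Enc α] [Enc β] [Enc τ]

theorem Rat.bits_list_sum_le {l : List ℚ} {K : ℕ} (h : ∀ x ∈ l, x.bits ≤ K) :
    l.sum.bits ≤ 2 + l.length * K := by
  induction l with
  | nil =>
    have : (0 : ℚ).bits = 2 := by
      simp only [Rat.bits, Rat.height2, Rat.num_zero, Rat.den_zero]
      decide
    simp [this]
  | cons x l ih =>
    have h1 := ih fun y hy => h y (by simp [hy])
    have h2 := h x (by simp)
    have h3 := Rat.bits_add_le x l.sum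
    rw [List.sum_cons, List.length_cons, add_mul]
    omega

theorem PolyTime.stacked {h : β → ℚ} (hh : PolyTime h) : PolyTime (stacked h) := by
  -- Each offset is recomputed from the objects already stacked, which the accumulator still
  -- contains.
  have heq : ∀ l : List β, l.foldr (fun x s => ((s.map fun e : ℚ × β => h e.2).sum, x) :: s) [] =
      _root_.stacked h l := by
    intro l
    induction l with
    | nil => rfl
    | cons x l ih =>
      rw [List.foldr_cons, ih, _root_.stacked]
      conv_rhs => rw [← map_snd_stacked h l, List.map_map]
      rw [map_snd_stacked]
      rfl
  obtain ⟨K, hK, hb⟩ := (id (α := List β)).exists_bdd_of_mem (f := fun p => h p.2)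
    (hh.comp id.snd)
  have hmem : ∀ (M : ℕ) (l : List β), (∀ x ∈ l, (h x).bits ≤ M) → ∀ e ∈ _root_.stacked h l,
      e.1.bits ≤ 2 + l.length * M := by
    intro M l hM
    induction l with
    | nil => simp [_root_.stacked]
    | cons x l ih =>
      intro e he
      have hM' : ∀ y ∈ l, (h y).bits ≤ M := fun y hy => hM y (by simp [hy])
      rw [List.length_cons, add_mul]
      rcases List.mem_cons.1 he with rfl | he
      · have := Rat.bits_list_sum_le (l := l.map h) (K := M) (by simpa using hM')
        rw [List.length_map] at this
        dsimp only
        omega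
      · have := ih hM' e he
        omega
  have := PolyTime.foldr (id (α := List β)) (.const ([] : List (ℚ × β)))
    (f := fun q => ((q.2.1.map fun e : ℚ × β => h e.2).sum, q.2.2) :: q.2.1)
    (((PolyTime.list_sum (id.snd.fst.map (f := fun _ (e : ℚ × β) => h e.2)
      (hh.comp id.snd.snd))).pair id.snd.snd).cons id.snd.fst)
    (B := fun l => 2 + sz l * (1 + (1 + (2 * (2 + sz l * (K l + 1)) + 1) + sz l)))
    ((PolyBdd.const 2).add (PolyBdd.sz.mul ((PolyBdd.const 1).add (((PolyBdd.const 1).add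
      (((PolyBdd.const 2).mul ((PolyBdd.const 2).add (PolyBdd.sz.mul (hK.add (.const 1))))).add
        (.const 1))).add .sz)))) (fun l l₂ hl => by
      dsimp only
      rw [heq]
      have hlen : l₂.length ≤ sz l := hl.length_le.trans (length_le_sz l)
      refine (sz_le_of_forall_mem (n := 1 + (2 * (2 + sz l * (K l + 1)) + 1) + sz l)
        fun e he => ?_).trans (Nat.add_le_add_left (Nat.mul_le_mul_right _ (by
          rwa [← List.length_map (as := _root_.stacked h l₂) Prod.snd, map_snd_stacked])) _)
      have h1 := hmem (K l + 1) l₂ (fun x hx => ((h x).bits_le).trans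
        (Nat.add_le_add_right (hb l x (hl.subset hx)) 1)) e he
      have h2 := sz_rat_le e.1
      have h3 : sz e.2 ≤ sz l := sz_le_of_mem (hl.subset (by
        rw [← map_snd_stacked h l₂]
        exact List.mem_map_of_mem he))
      have h4 := Nat.mul_le_mul_right (K l + 1) hlen
      change 1 + sz e.1 + sz e.2 ≤ _
      omega)
  simpa only [heq] using this

theorem PolyTime.sortBy {h : β → ℚ} (hh : PolyTime h) : PolyTime (sortBy h) := by
  have hlt : PolyDec fun q : (List β × List β × β) × β => h q.2 < h q.1.2.2 :=
    .lt (hh.comp PolyTime.id.snd) (hh.comp PolyTime.id.fst.snd.snd)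
  exact PolyTime.foldr_of_growth (id (α := List β)) (.const ([] : List β))
    (f := fun q => insertBy h q.2.2 q.2.1)
    ((id.snd.fst.filter (p := fun q y => h y < h q.2.2) hlt).append
      (id.snd.snd.cons (id.snd.fst.filter (p := fun q y => ¬ h y < h q.2.2) hlt.not)))
    (K := fun l => 1 + sz l) ((PolyBdd.const 1).add .sz) (fun l s x hx => by
      have := sz_le_of_mem hx
      dsimp only
      rw [(insertBy_perm h x s).sz_eq, sz_cons]
      omega)

theorem PolyTime.shelves {wd : β → ℚ} (hw : PolyTime wd) : PolyTime (shelves wd) := by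
  have hstep : PolyTime fun q : List β × List (List β) × β => addToShelves wd q.2.2 q.2.1 := by
    have := PolyTime.list_cases (α := List β × List (List β) × β) (l := fun q => q.2.1)
      (f := fun q => [[q.2.2]])
      (g := fun q s ss => if (s.map wd).sum + wd q.2.2 ≤ 1 then (q.2.2 :: s) :: ss
        else [q.2.2] :: s :: ss) id.snd.fst ((id.snd.snd.cons (.const [])).cons (.const []))
      (.ite (.le (((id.snd.fst.map (f := fun _ x => wd x) (hw.comp id.snd)).list_sum).add
          (hw.comp id.fst.snd.snd)) (.const 1))
        ((id.fst.snd.snd.cons id.snd.fst).cons id.snd.snd)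
        ((id.fst.snd.snd.cons (.const [])).cons (id.snd.fst.cons id.snd.snd)))
    convert this using 2 with q
    obtain ⟨-, ss, x⟩ := q
    cases ss <;> rfl
  exact PolyTime.foldr_of_growth (id (α := List β)) (.const ([] : List (List β)))
    (f := fun q => addToShelves wd q.2.2 q.2.1) hstep
    (K := fun l => 4 + sz l) ((PolyBdd.const 4).add .sz) (fun l s x hx => by
      have := sz_le_of_mem hx
      dsimp only
      cases s with
      | nil => simp only [addToShelves, sz_cons, sz_nil]; omega
      | cons s ss =>
        rw [addToShelves]
        split_ifs <;> simp only [sz_cons, sz_nil] <;> omega)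

theorem PolyTime.shelfHeight {h : β → ℚ} (hh : PolyTime h) : PolyTime (shelfHeight h) := by
  obtain ⟨K, hK, hb⟩ := (id (α := List β)).exists_bdd_of_mem (f := fun p => h p.2)
    (hh.comp id.snd)
  exact PolyTime.foldr_of_growth (id (α := List β)) (.const (0 : ℚ))
    (f := fun q => if q.2.1 ≤ h q.2.2 then h q.2.2 else q.2.1)
    (.ite (.le id.snd.fst (hh.comp id.snd.snd)) (hh.comp id.snd.snd) id.snd.fst)
    hK (fun l s x hx => by
      have := hb l x hx
      dsimp only at this ⊢
      split_ifs <;> omega)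

theorem PolyTime.alternate : PolyTime (alternate (β := β)) :=
  PolyTime.foldr_of_growth (id (α := List β)) (.const (([] : List β), ([] : List β)))
    (f := fun q => (q.2.2 :: q.2.1.2, q.2.1.1))
    ((id.snd.snd.cons id.snd.fst.snd).pair id.snd.fst.fst)
    (K := fun l => 1 + sz l) ((PolyBdd.const 1).add .sz) (fun l s x hx => by
      have := sz_le_of_mem hx
      obtain ⟨s, s'⟩ := s
      simp only [sz_pair, sz_cons]
      omega)

theorem PolyTime.placeShelves {d : ℕ}
    {pk : List (τ × (Fin d → ℚ)) → List (τ × ℕ × (Fin d → ℚ))} (hpk : PolyTime pk) (c : ℕ) :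
    PolyTime (placeShelves pk c) := by
  have hin : PolyTime fun s : List (τ × (Fin (d + 1) → ℚ)) =>
      pk (s.map fun x => (x.1, fun j => x.2 j.succ)) :=
    hpk.comp (id.map (f := fun _ (x : τ × (Fin (d + 1) → ℚ)) =>
      ((x.1, fun j => x.2 j.succ) : τ × (Fin d → ℚ))) (id.snd.fst.pair id.snd.snd.vec_tail))
  exact (PolyTime.stacked (PolyTime.shelfHeight (h := fun x : τ × (Fin (d + 1) → ℚ) => x.2 0)
      (id.snd.get 0))).flatMap
    (f := fun _ (e : ℚ × List (τ × (Fin (d + 1) → ℚ))) =>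
      (pk (e.2.map fun x => (x.1, fun j => x.2 j.succ))).map fun q =>
        ((q.1, 3 * q.2.1 + c, Fin.cons e.1 q.2.2) : τ × ℕ × (Fin (d + 1) → ℚ)))
    ((hin.comp id.snd.snd).map (f := fun q (r : τ × ℕ × (Fin d → ℚ)) =>
        ((r.1, 3 * r.2.1 + c, Fin.cons q.2.1 r.2.2) : τ × ℕ × (Fin (d + 1) → ℚ)))
      (id.snd.fst.pair (((nat_mul (.const 3) id.snd.snd.fst).nat_add (.const c)).pair
        (id.fst.snd.fst.vec_cons id.snd.snd.snd))))

/-- The dimension is constant, so the recursion is a fixed nesting of polynomial-time functions. -/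
theorem PolyTime.packBoxes (d : ℕ) : PolyTime (packBoxes (α := τ) d) := by
  induction d with
  | zero =>
    exact (PolyTime.stacked (h := fun x : τ × (Fin 1 → ℚ) => x.2 0) (id.snd.get 0)).map
      (f := fun _ (e : ℚ × τ × (Fin 1 → ℚ)) => ((e.2.1, 0, fun _ => e.1) : τ × ℕ × (Fin 1 → ℚ)))
      (id.snd.snd.fst.pair ((PolyTime.const 0).pair (.vec fun _ => id.snd.fst)))
  | succ d ih =>
    have hs : PolyTime fun l : List (τ × (Fin (d + 2) → ℚ)) =>
        (_root_.shelves (fun x => ∏ j : Fin (d + 1), x.2 j.succ)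
          (_root_.sortBy (fun x => x.2 0) l)).reverse :=
      ((PolyTime.shelves (PolyTime.prod_fin (f := fun (x : τ × (Fin (d + 2) → ℚ)) j => x.2 j.succ)
        fun j => id.snd.get j.succ)).comp (PolyTime.sortBy (id.snd.get 0))).reverse
    have := hs.list_cases (f := fun _ => []) (g := fun _ s ss =>
        _root_.placeShelves (_root_.packBoxes d) 0 [s] ++
          (_root_.placeShelves (_root_.packBoxes d) 1 (_root_.alternate ss).1 ++
            _root_.placeShelves (_root_.packBoxes d) 2 (_root_.alternate ss).2)) (.const _)
      (((PolyTime.placeShelves ih 0).comp (id.snd.fst.cons (.const []))).append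
        (((PolyTime.placeShelves ih 1).comp (PolyTime.alternate.comp id.snd.snd).fst).append
          ((PolyTime.placeShelves ih 2).comp (PolyTime.alternate.comp id.snd.snd).snd)))
    convert this using 1
    funext l
    rw [_root_.packBoxes]
    cases (_root_.shelves (fun x => ∏ j : Fin (d + 1), x.2 j.succ)
      (_root_.sortBy (fun x => x.2 0) l)).reverse <;> rfl

end ShelvesPolyTime

/-! ### Geometric-vector knapsack -/

namespace GVKSInstance

variable {dg dv : ℕ} (I : GVKSInstance dg dv)

/-- Items that can be packed into one bin have total volume at most 1. -/
theorem sum_volume_le_one {S : Finset (Fin I.n)} {x : Fin I.n → Fin dg → ℝ}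
    (h : I.IsPacking S x) : ∑ i ∈ S, ∏ j, I.len i j ≤ 1 := by
  obtain ⟨h1, h2, -⟩ := h
  have hvol : ∀ i, MeasureTheory.volume (I.openBox x i) =
      ENNReal.ofReal (∏ j, (I.len i j : ℝ)) := fun i => by
    rw [openBox, Real.volume_pi_Ioo, ENNReal.ofReal_prod_of_nonneg]
    · simp
    · intro j _
      exact_mod_cast I.len_nonneg i j
  -- Comparing Lebesgue measures works for arbitrary real positions, over which the optimum ranges.
  have hsub : (⋃ i ∈ S, I.openBox x i) ⊆ Set.Icc (0 : Fin dg → ℝ) 1 := by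
    intro y hy
    simp only [Set.mem_iUnion, openBox, Set.mem_pi, Set.mem_univ, true_implies, Set.mem_Ioo] at hy
    obtain ⟨i, hi, hy⟩ := hy
    exact ⟨fun j => (h1 i hi j).1.trans (hy j).1.le, fun j => (hy j).2.le.trans (h1 i hi j).2⟩
  have hle := MeasureTheory.measure_mono (μ := MeasureTheory.volume) hsub
  rw [MeasureTheory.measure_biUnion_finset (fun i hi i' hi' hne => h2 i hi i' hi' hne)
    fun i _ => MeasurableSet.univ_pi fun j => measurableSet_Ioo, Real.volume_Icc_pi] at hle
  simp only [hvol] at hle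
  rw [← ENNReal.ofReal_sum_of_nonneg fun i _ =>
    Finset.prod_nonneg fun j _ => by exact_mod_cast I.len_nonneg i j] at hle
  have hle' : ∑ i ∈ S, ∏ j, (I.len i j : ℝ) ≤ 1 := by
    simpa using hle
  exact_mod_cast hle'

theorem feasible_toVKS_of_packable {S : Finset (Fin I.n)} (h : I.Packable S) :
    I.toVKS.Feasible S := by
  obtain ⟨x, hx⟩ := h
  intro k
  refine Fin.cases ?_ (fun k => ?_) k
  · exact I.sum_volume_le_one hx
  · exact hx.2.2 k

/-- Positions without overlap in a separated sense give a packing. -/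
theorem isPacking_of_apart {S : Finset (Fin I.n)} {x : Fin I.n → Fin dg → ℚ}
    (h1 : ∀ i ∈ S, ∀ j, 0 ≤ x i j ∧ x i j + I.len i j ≤ 1)
    (h2 : ∀ i ∈ S, ∀ i' ∈ S, i ≠ i' → ∃ j,
      x i j + I.len i j ≤ x i' j ∨ x i' j + I.len i' j ≤ x i j)
    (h3 : ∀ k, ∑ i ∈ S, I.wt i k ≤ 1) : I.IsPacking S fun i j => (x i j : ℝ) := by
  refine ⟨fun i hi j => by dsimp only; exact_mod_cast h1 i hi j, fun i hi i' hi' hne => ?_, h3⟩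
  rw [Set.disjoint_left]
  intro y hy hy'
  simp only [openBox, Set.mem_pi, Set.mem_univ, true_implies, Set.mem_Ioo] at hy hy'
  obtain ⟨j, hj | hj⟩ := h2 i hi i' hi' hne
  · have hj' : (x i j : ℝ) + (I.len i j : ℝ) ≤ (x i' j : ℝ) := by exact_mod_cast hj
    linarith [(hy j).2, (hy' j).1]
  · have hj' : (x i' j : ℝ) + (I.len i' j : ℝ) ≤ (x i j : ℝ) := by exact_mod_cast hj
    linarith [(hy' j).2, (hy j).1]

/-- The list of the items, each given by its profit, its side lengths and its weights. -/
def data : List (ℚ × (Fin dg → ℚ) × (Fin dv → ℚ)) :=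
  List.ofFn fun i => (I.profit i, I.len i, I.wt i)

theorem encode_eq : I.encode = enc I.data := by
  rw [encode, data]
  simp only [enc, List.map_ofFn]
  rfl

end GVKSInstance

/-! ### From a vector knapsack solution to the best bin -/

section BestBin

variable {d dv : ℕ}

/-- Replace the side lengths of every item by its volume. -/
def volumeData (l : List (ℚ × (Fin d → ℚ) × (Fin dv → ℚ))) : List (ℚ × (Fin (dv + 1) → ℚ)) :=
  l.map fun x => (x.1, Fin.cons (∏ j, x.2.1 j) x.2.2)

theorem encode_toVKS (I : GVKSInstance d dv) : I.toVKS.encode = enc (volumeData I.data) := by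
  rw [VKSInstance.encode_eq, volumeData, GVKSInstance.data, List.map_ofFn]
  rfl

theorem PolyTime.volumeData : PolyTime (volumeData (d := d) (dv := dv)) :=
  id.map (f := fun _ (x : ℚ × (Fin d → ℚ) × (Fin dv → ℚ)) =>
      ((x.1, Fin.cons (∏ j, x.2.1 j) x.2.2) : ℚ × (Fin (dv + 1) → ℚ)))
    (id.snd.fst.pair ((PolyTime.prod_fin (f := fun (p : _ × _ × (Fin d → ℚ) × (Fin dv → ℚ)) j =>
      p.2.2.1 j) fun j => id.snd.snd.fst.get j).vec_cons id.snd.snd.snd))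

/-- The selected items, each given by its number, its profit and its side lengths. -/
def selectedBoxes (l : List (ℚ × (Fin d → ℚ) × (Fin dv → ℚ))) (J : List ℕ) :
    List ((ℕ × ℚ) × (Fin d → ℚ)) :=
  ((numbered l.reverse).filter fun x => ∃ j ∈ J, j = x.1).map fun x => ((x.1, x.2.1), x.2.2.1)

/-- The boxes in bin `k`. -/
def binOf {τ : Type} (E : List (τ × ℕ × (Fin d → ℚ))) (k : ℕ) : List (τ × ℕ × (Fin d → ℚ)) :=
  E.filter fun e => e.2.1 = k

/-- A most profitable one of the first `b` bins. -/
def bestBin (b : ℕ) (E : List ((ℕ × ℚ) × ℕ × (Fin d → ℚ))) : List ((ℕ × ℚ) × ℕ × (Fin d → ℚ)) :=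
  best (fun F => (F.map fun e => e.1.2).sum) (binOf E 0) ((List.range b).map (binOf E))

/-- The numbers and the positions of the boxes in the best bin. -/
def bestBinOutput (b : ℕ) (q : List (ℚ × (Fin (d + 1) → ℚ) × (Fin dv → ℚ)) × List ℕ) :
    List (ℕ × (Fin (d + 1) → ℚ)) :=
  (bestBin b (packBoxes d (selectedBoxes q.1 q.2))).map fun e => (e.1.1, e.2.2)

theorem PolyTime.selectedBoxes {α : Type} [Enc α]
    {l : α → List (ℚ × (Fin d → ℚ) × (Fin dv → ℚ))} {J : α → List ℕ} (hl : PolyTime l)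
    (hJ : PolyTime J) : PolyTime fun a => _root_.selectedBoxes (l a) (J a) := by
  have h : PolyTime fun a => (_root_.numbered (l a).reverse).filter fun x => ∃ j ∈ J a, j = x.1 :=
    hl.reverse.numbered.filter
      (p := fun a (x : ℕ × ℚ × (Fin d → ℚ) × (Fin dv → ℚ)) => ∃ j ∈ J a, j = x.1)
      (PolyDec.exists_mem (p := fun (q : α × (ℕ × ℚ × (Fin d → ℚ) × (Fin dv → ℚ))) (j : ℕ) =>
        j = q.2.1) (hJ.comp id.fst) (PolyDec.nat_eq id.snd id.fst.snd.fst))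
  exact h.map (f := fun _ (x : ℕ × ℚ × (Fin d → ℚ) × (Fin dv → ℚ)) => ((x.1, x.2.1), x.2.2.1))
    ((id.snd.fst.pair id.snd.snd.fst).pair id.snd.snd.snd.fst)

theorem PolyTime.binOf {α τ : Type} [Enc α] [Enc τ] {E : α → List (τ × ℕ × (Fin d → ℚ))}
    {k : α → ℕ} (hE : PolyTime E) (hk : PolyTime k) :
    PolyTime fun a => _root_.binOf (E a) (k a) :=
  hE.filter (p := fun a (e : τ × ℕ × (Fin d → ℚ)) => e.2.1 = k a)
    (PolyDec.nat_eq id.snd.snd.fst (hk.comp id.fst))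

theorem PolyTime.bestBin (b : ℕ) : PolyTime (bestBin (d := d) b) := by
  have hp : PolyTime fun F : List ((ℕ × ℚ) × ℕ × (Fin d → ℚ)) => (F.map fun e => e.1.2).sum :=
    PolyTime.list_sum (id.map (f := fun _ (e : (ℕ × ℚ) × ℕ × (Fin d → ℚ)) => e.1.2)
      id.snd.fst.snd)
  have h0 : PolyTime fun E : List ((ℕ × ℚ) × ℕ × (Fin d → ℚ)) => _root_.binOf E 0 :=
    PolyTime.binOf id (PolyTime.const 0)
  have hr : PolyTime fun _ : List ((ℕ × ℚ) × ℕ × (Fin d → ℚ)) => List.range b :=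
    PolyTime.const _
  have hb : PolyTime fun E : List ((ℕ × ℚ) × ℕ × (Fin d → ℚ)) =>
      (List.range b).map (_root_.binOf E) :=
    hr.map (f := fun E k => _root_.binOf E k) (PolyTime.binOf id.fst id.snd)
  have hq : PolyTime fun q : List ((ℕ × ℚ) × ℕ × (Fin d → ℚ)) ×
      List ((ℕ × ℚ) × ℕ × (Fin d → ℚ)) => (q.2.map fun e => e.1.2).sum := hp.comp id.snd
  have h := PolyTime.best (p := fun (_ F : List ((ℕ × ℚ) × ℕ × (Fin d → ℚ))) =>
    (F.map fun e => e.1.2).sum) hq h0 hb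
  exact h

theorem PolyTime.bestBinOutput (b : ℕ) : PolyTime (bestBinOutput (d := d) (dv := dv) b) := by
  have h : PolyTime fun q : List (ℚ × (Fin (d + 1) → ℚ) × (Fin dv → ℚ)) × List ℕ =>
      _root_.bestBin b (_root_.packBoxes d (_root_.selectedBoxes q.1 q.2)) :=
    (PolyTime.bestBin b).comp ((PolyTime.packBoxes d).comp (PolyTime.selectedBoxes id.fst id.snd))
  exact h.map (f := fun _ (e : (ℕ × ℚ) × ℕ × (Fin (d + 1) → ℚ)) => (e.1.1, e.2.2))
    (id.snd.fst.fst.pair id.snd.snd.snd)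

/-- Turns the list produced by the packing algorithm into bin numbers and positions given as
functions of the item. -/
theorem exists_eq_map_of_map_fst {ι τ γ : Type} [Nonempty γ] [DecidableEq ι] {f : ι → τ}
    {E : List (τ × γ)} (h : ∀ e ∈ E, ∃ i, e.1 = f i) (hE : (E.map Prod.fst).Nodup) :
    ∃ (L : List ι) (g : ι → γ), L.Nodup ∧ E = L.map fun i => (f i, g i) := by
  induction E with
  | nil => exact ⟨[], fun _ => Classical.arbitrary γ, by simp⟩
  | cons e E ih =>
    rw [List.map_cons, List.nodup_cons] at hE
    obtain ⟨L, g, hL, rfl⟩ := ih (fun e' he' => h e' (by simp [he'])) hE.2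
    obtain ⟨i, hi⟩ := h e (by simp)
    have hiL : i ∉ L := fun hiL => hE.1 (by
      rw [List.map_map, hi]
      exact List.mem_map.2 ⟨i, hiL, rfl⟩)
    refine ⟨i :: L, Function.update g i e.2, List.nodup_cons.2 ⟨hiL, hL⟩, ?_⟩
    rw [List.map_cons, Function.update_self, ← hi]
    congr 1
    refine List.map_congr_left fun j hj => ?_
    rw [Function.update_of_ne]
    rintro rfl
    exact hiL hj

/-- Equality holds up to dimension 3; from dimension 4 on, the surplus bins stay empty. -/
theorem three_pow_le_binCount (d : ℕ) : 3 ^ d ≤ binCount (d + 1) := by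
  match d with
  | 0 => simp [binCount]
  | 1 => simp [binCount]
  | 2 => simp [binCount]
  | d + 3 =>
    change 3 ^ (d + 3) ≤ 4 ^ (d + 4) + 2 ^ (d + 4)
    calc 3 ^ (d + 3) ≤ 4 ^ (d + 3) := Nat.pow_le_pow_left (by norm_num) _
      _ ≤ 4 ^ (d + 4) := Nat.pow_le_pow_right (by norm_num) (by omega)
      _ ≤ _ := Nat.le_add_right _ _

/-- A selection of total volume and weights at most 1 splits into bins, one of which is output. -/
theorem bestBinOutput_spec (I : GVKSInstance (d + 1) dv) {J : List (Fin I.n)} (hJ : J.Nodup)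
    (hf : I.toVKS.Feasible J.toFinset) :
    ∃ (bins : Fin (binCount (d + 1)) → Finset (Fin I.n)) (k : Fin (binCount (d + 1)))
      (l : List (Fin I.n)) (x : Fin I.n → Fin (d + 1) → ℚ),
      Finset.univ.biUnion bins = J.toFinset ∧
      (∀ a a', a ≠ a' → Disjoint (bins a) (bins a')) ∧
      (∀ a, I.Packable (bins a)) ∧
      (∀ a, I.totalProfit (bins a) ≤ I.totalProfit (bins k)) ∧
      l.toFinset = bins k ∧ l.Nodup ∧ I.IsPacking l.toFinset (fun i j => (x i j : ℝ)) ∧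
      bestBinOutput (binCount (d + 1)) (I.data, J.map fun i : Fin I.n => (i : ℕ)) =
        l.map fun i : Fin I.n => ((i : ℕ), x i) := by
  set b := binCount (d + 1) with hb
  have hbpos : 0 < b := lt_of_lt_of_le (by positivity) (three_pow_le_binCount d)
  let f : Fin I.n → ℕ × ℚ := fun i => ((i : ℕ), I.profit i)
  have hfinj : Function.Injective f := fun i j h => Fin.ext (congrArg Prod.fst h)
  -- The packed boxes are labelled by number and profit; the value 0 for labels outside the instance
  -- is never used.
  let len : ℕ × ℚ → Fin (d + 1) → ℚ := fun t => if h : t.1 < I.n then I.len ⟨t.1, h⟩ else 0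
  have hlenf : ∀ i, len (f i) = I.len i := fun i => by simp [len, f]
  set B := selectedBoxes I.data (J.map fun i : Fin I.n => (i : ℕ)) with hB
  have hBperm : B.Perm (J.map fun i => (f i, I.len i)) := by
    have hn : ((numbered I.data.reverse).map Prod.fst).Nodup := by
      rw [map_fst_numbered]
      simp [List.nodup_range]
    let g : Fin I.n → ℕ × ℚ × (Fin (d + 1) → ℚ) × (Fin dv → ℚ) := fun i =>
      ((i : ℕ), I.profit i, I.len i, I.wt i)
    have hginj : Function.Injective g := fun i j h => Fin.ext (congrArg Prod.fst h)
    have : ((numbered I.data.reverse).filter fun x =>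
        ∃ j ∈ J.map fun i : Fin I.n => (i : ℕ), j = x.1).Perm (J.map g) := by
      rw [List.perm_ext_iff_of_nodup ((hn.of_map _).filter _) (hJ.map hginj)]
      intro x
      rw [List.mem_filter, GVKSInstance.data, mem_numbered_ofFn]
      simp only [decide_eq_true_eq, List.mem_map]
      constructor
      · rintro ⟨⟨i, rfl⟩, j, ⟨i', hi', rfl⟩, hii⟩
        obtain rfl : i' = i := Fin.ext hii
        exact ⟨i', hi', rfl⟩
      · rintro ⟨i, hi, rfl⟩
        exact ⟨⟨i, rfl⟩, _, ⟨i, hi, rfl⟩, rfl⟩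
    have h := this.map fun x => ((x.1, x.2.1), x.2.2.1)
    rw [List.map_map] at h
    exact h
  have hBmem : ∀ y ∈ B, ∃ i ∈ J, y = (f i, I.len i) := fun y hy => by
    obtain ⟨i, hi, rfl⟩ := List.mem_map.1 (hBperm.subset hy)
    exact ⟨i, hi, rfl⟩
  obtain ⟨hperm, hpack⟩ := packBoxes_spec d (len := len) (l := B)
    (fun y hy => by
      obtain ⟨i, -, rfl⟩ := hBmem y hy
      exact (hlenf i).symm)
    (fun y hy j => by
      obtain ⟨i, -, rfl⟩ := hBmem y hy
      exact ⟨I.len_nonneg i j, I.len_le_one i j⟩)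
    (by
      rw [(hBperm.map _).sum_eq, List.map_map, ← List.sum_toFinset _ hJ]
      exact hf 0)
  have hperm' : ((packBoxes d B).map Prod.fst).Perm (J.map f) := by
    have h := hBperm.map Prod.fst
    rw [List.map_map] at h
    exact hperm.trans h
  obtain ⟨L, g, hL, hE⟩ := exists_eq_map_of_map_fst (f := f) (E := packBoxes d B)
    (fun e he => by
      obtain ⟨i, -, hi⟩ := List.mem_map.1 (hperm'.subset (List.mem_map_of_mem (f := Prod.fst) he))
      exact ⟨i, hi.symm⟩) (hperm'.nodup_iff.2 (hJ.map hfinj))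
  have hLJ : ∀ i, i ∈ L ↔ i ∈ J := fun i => by
    have h := hperm'.mem_iff (a := f i)
    rw [hE, List.map_map] at h
    have e1 : f i ∈ List.map (Prod.fst ∘ fun i => (f i, g i)) L ↔ i ∈ L :=
      List.mem_map_of_injective (f := f) hfinj
    rw [e1, List.mem_map_of_injective hfinj] at h
    exact h
  let bl : ℕ → List (Fin I.n) := fun k => L.filter fun i => (g i).1 = k
  have hblnd : ∀ k, (bl k).Nodup := fun k => hL.filter _
  have hbin : ∀ k, binOf (packBoxes d B) k = (bl k).map fun i => (f i, g i) := fun k => by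
    rw [hE, binOf, List.filter_map]
    rfl
  have hprofit : ∀ k, ((binOf (packBoxes d B) k).map fun e => e.1.2).sum =
      I.totalProfit (bl k).toFinset := fun k => by
    rw [hbin, List.map_map, GVKSInstance.totalProfit, List.sum_toFinset _ (hblnd k)]
    rfl
  have hmemE : ∀ i ∈ L, (f i, g i) ∈ packBoxes d B := fun i hi => by
    rw [hE]
    exact List.mem_map_of_mem (f := fun i => (f i, g i)) hi
  have hpacking : ∀ k, I.IsPacking (bl k).toFinset fun i j => (((g i).2 j : ℚ) : ℝ) := by
    intro k
    have hsub : ∀ i ∈ (bl k).toFinset, i ∈ L ∧ (g i).1 = k := fun i hi => by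
      simpa [bl] using hi
    refine I.isPacking_of_apart (x := fun i => (g i).2) (fun i hi j => ?_)
      (fun i hi i' hi' hne => ?_) fun k' => ?_
    · have := hpack.inside _ (hmemE i (hsub i hi).1) j
      rwa [hlenf] at this
    · have hap := hpack.apart
      rw [hE, List.pairwise_map] at hap
      -- Separation is known only for pairs in list order; symmetry extends it to all pairs.
      have hsymm : Std.Symm fun i i' : Fin I.n => (g i).1 = (g i').1 → ∃ j,
          (g i).2 j + len (f i) j ≤ (g i').2 j ∨ (g i').2 j + len (f i') j ≤ (g i).2 j :=
        ⟨fun i i' h hii => by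
          obtain ⟨j, hj⟩ := h hii.symm
          exact ⟨j, hj.symm⟩⟩
      have := hap.forall (hsub i hi).1 (hsub i' hi').1 hne
        ((hsub i hi).2.trans (hsub i' hi').2.symm)
      simpa only [hlenf] using this
    -- The weight constraints pass from the whole selection to each bin; coordinate `k'.succ` skips
    -- the volume.
    · refine le_trans (Finset.sum_le_sum_of_subset_of_nonneg (fun i hi => ?_)
        fun i _ _ => I.wt_nonneg i k') (hf k'.succ)
      exact List.mem_toFinset.2 ((hLJ i).1 (hsub i hi).1)
  have hbest := best_mem (fun F : List ((ℕ × ℚ) × ℕ × (Fin (d + 1) → ℚ)) =>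
    (F.map fun e => e.1.2).sum) (binOf (packBoxes d B) 0)
    ((List.range b).map (binOf (packBoxes d B)))
  have hle := le_best (fun F : List ((ℕ × ℚ) × ℕ × (Fin (d + 1) → ℚ)) =>
    (F.map fun e => e.1.2).sum) (binOf (packBoxes d B) 0)
    ((List.range b).map (binOf (packBoxes d B)))
  obtain ⟨k, hk⟩ : ∃ k : Fin b, bestBin b (packBoxes d B) = binOf (packBoxes d B) k := by
    rcases List.mem_cons.1 hbest with h | h
    · exact ⟨⟨0, hbpos⟩, h⟩
    · obtain ⟨k, hk, hk'⟩ := List.mem_map.1 h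
      exact ⟨⟨k, List.mem_range.1 hk⟩, hk'.symm⟩
  refine ⟨fun a => (bl a).toFinset, k, bl k, fun i => (g i).2, ?_, fun a a' hne => ?_,
    fun a => ⟨_, hpacking a⟩, fun a => ?_, rfl, hblnd k, hpacking k, ?_⟩
  · ext i
    simp only [Finset.mem_biUnion, Finset.mem_univ, true_and, List.mem_toFinset, bl,
      List.mem_filter, decide_eq_true_eq, ← hLJ]
    constructor
    · rintro ⟨-, h, -⟩
      exact h
    · intro h
      exact ⟨⟨(g i).1, (hpack.bin_lt _ (hmemE i h)).trans_le (three_pow_le_binCount d)⟩, h, rfl⟩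
  · rw [Finset.disjoint_left]
    intro i hi hi'
    simp only [List.mem_toFinset, bl, List.mem_filter, decide_eq_true_eq] at hi hi'
    exact hne (Fin.ext (hi.2.symm.trans hi'.2))
  · have h := hle (binOf (packBoxes d B) a) (List.mem_cons_of_mem _
      (List.mem_map_of_mem (List.mem_range.2 a.2)))
    change _ ≤ (List.map _ (bestBin b (packBoxes d B))).sum at h
    rw [hk] at h
    rwa [hprofit, hprofit] at h
  · rw [bestBinOutput]
    change (bestBin b (packBoxes d B)).map _ = _
    rw [hk, hbin, List.map_map]
    rfl

theorem encodePacking_eq {n m : ℕ} (l : List (Fin n)) (x : Fin n → Fin m → ℚ) :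
    encodePacking l x = enc (l.map fun i : Fin n => ((i : ℕ), x i)) := by
  simp only [encodePacking, enc, List.map_map]
  rfl

/-- Running a polynomial-time program for vector knapsack, splitting its output into bins and
choosing the best bin. -/
theorem exists_bestBin_program {A : RCode} {α : ℝ} (hα : 0 ≤ α) (hA : IsVKSApprox (dv + 1) α A) :
    ∃ B : RCode, OutputsBestBin (d + 1) dv A B ∧
      IsGVKSApprox (d + 1) dv (binCount (d + 1) * α) B := by
  obtain ⟨P, hP⟩ := hA
  obtain ⟨k, hk⟩ := P.exists_eval_le_pow
  obtain ⟨c, T, hT, hc⟩ := PolyTime.volumeData (d := d + 1) (dv := dv)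
  obtain ⟨e, U, ⟨j, hU⟩, he⟩ := PolyTime.bestBinOutput (d := d) (dv := dv) (binCount (d + 1))
  have hvol := (PolyTime.volumeData (d := d + 1) (dv := dv)).polyBdd
  let R : List (ℚ × (Fin (d + 1) → ℚ) × (Fin dv → ℚ)) → ℕ := fun l => (sz (volumeData l) + 2) ^ k
  have hR : PolyBdd R := (hvol.add (.const 2)).pow k
  obtain ⟨m, hm⟩ : PolyBdd fun l : List (ℚ × (Fin (d + 1) → ℚ) × (Fin dv → ℚ)) =>
      1 + (1 + (1 + sz l + sz l) + (1 + T l + R l)) + (1 + sz l + R l + 2) ^ j :=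
    ((PolyBdd.const 1).add (((PolyBdd.const 1).add (((PolyBdd.const 1).add .sz).add .sz)).add
      (((PolyBdd.const 1).add hT).add hR))).add
        (((((PolyBdd.const 1).add .sz).add hR).add (.const 2)).pow j)
  have main : ∀ I : GVKSInstance (d + 1) dv,
      ∃ (J : List (Fin I.n)) (bins : Fin (binCount (d + 1)) → Finset (Fin I.n))
        (k : Fin (binCount (d + 1))) (l : List (Fin I.n)) (x : Fin I.n → Fin (d + 1) → ℚ) (t : ℕ),
        A.Outputs I.toVKS.encode (encodeSelection J) ∧
        (Finset.univ.biUnion bins = J.toFinset ∧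
        (∀ a a', a ≠ a' → Disjoint (bins a) (bins a')) ∧
        (∀ a, I.Packable (bins a)) ∧
        (∀ a, I.totalProfit (bins a) ≤ I.totalProfit (bins k)) ∧
        l.toFinset = bins k ∧ l.Nodup ∧ I.IsPacking l.toFinset (fun i j => (x i j : ℝ))) ∧
        (RCode.seq (.fork (.prim .id) (.seq c A)) e).Runs I.encode (encodePacking l x) t ∧
        t ≤ (sz I.data + 2) ^ m ∧
        ∀ S : Finset (Fin I.n), I.toVKS.Feasible S →
          (I.totalProfit S : ℝ) ≤ α * (I.totalProfit J.toFinset : ℝ) := by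
    intro I
    obtain ⟨w, s, hs, hsP, J, rfl, hJ, hf, hopt⟩ := hP I.toVKS
    obtain ⟨bins, b, l, x, h1, h2, h3, h4, h5, h6, h7, h8⟩ := bestBinOutput_spec I hJ hf
    obtain ⟨r, hr, hr'⟩ := hc I.data
    obtain ⟨t, ht, ht'⟩ := he (I.data, J.map fun i : Fin I.n => (i : ℕ))
    have hsR : s ≤ R I.data := by
      refine hsP.trans ?_
      rw [encode_toVKS]
      exact hk _ _ le_rfl
    have hsz := hs.size_le.2
    have hs' := hs
    rw [encode_toVKS, encodeSelection_eq] at hs'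
    rw [h8, ← encodePacking_eq] at ht'
    refine ⟨J, bins, b, l, x, 1 + (1 + (1 + sz I.data + sz I.data) + (1 + r + s)) + t, ⟨s, hs⟩,
      ⟨h1, h2, h3, h4, h5, h6, h7⟩, ?_, ?_, hopt⟩
    · rw [I.encode_eq]
      exact ((RCode.Runs.prim .id _).fork (hr'.seq hs')).seq ht'
    · refine le_trans ?_ (hm I.data)
      -- The output of `A` is no longer than its running time, so the packing stage starts from a
      -- polynomially long input.
      have hszJ : sz (J.map fun i : Fin I.n => (i : ℕ)) ≤ s := by
        rw [encodeSelection_eq] at hsz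
        exact hsz
      have ht2 : t ≤ (1 + sz I.data + R I.data + 2) ^ j := by
        refine (ht.trans (hU _)).trans (Nat.pow_le_pow_left ?_ j)
        rw [sz_pair]
        omega
      dsimp only
      omega
  -- The input is kept next to the output of `A`, since the packing stage needs the side lengths
  -- that the vector instance has lost.
  refine ⟨.seq (.fork (.prim .id) (.seq c A)) e, fun I => ?_, (Polynomial.X + 2) ^ m, fun I => ?_⟩
  · obtain ⟨J, bins, k, l, x, t, hA, ⟨h1, h2, h3, h4, h5, -, -⟩, hr, -⟩ := main I
    exact ⟨J, bins, k, l, x, hA, h1, h2, h3, h4, h5, t, hr⟩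
  · obtain ⟨J, bins, k, l, x, t, -, ⟨h1, h2, -, h4, h5, h6, h7⟩, hr, ht, hopt⟩ := main I
    refine ⟨_, t, hr, ?_, l, x, rfl, h6, h7, fun S hS => ?_⟩
    · rw [I.encode_eq]
      simpa [sz] using ht
    · refine (hopt S (I.feasible_toVKS_of_packable hS)).trans ?_
      have hsum : I.totalProfit J.toFinset ≤
          binCount (d + 1) * I.totalProfit l.toFinset := by
        rw [GVKSInstance.totalProfit, ← h1, Finset.sum_biUnion fun a _ a' _ h => h2 a a' h, h5]
        refine (Finset.sum_le_sum fun a _ => h4 a).trans ?_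
        simp
      have hsum' : (I.totalProfit J.toFinset : ℝ) ≤
          binCount (d + 1) * (I.totalProfit l.toFinset : ℝ) := by exact_mod_cast hsum
      calc α * (I.totalProfit J.toFinset : ℝ)
          ≤ α * (binCount (d + 1) * (I.totalProfit l.toFinset : ℝ)) :=
            mul_le_mul_of_nonneg_left hsum' hα
        _ = _ := by ring

end BestBin

/-! ### The theorem -/

theorem mainTheorem9 (dg dv : ℕ) (hdg : 1 ≤ dg) :
    (∀ (α : ℝ) (A : RCode), 1 ≤ α → IsVKSApprox (dv + 1) α A →
      ∃ B : RCode, OutputsBestBin dg dv A B ∧ IsGVKSApprox dg dv (binCount dg * α) B) ∧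
    (∀ ε : ℝ, 0 < ε →
      ∃ A B : RCode, IsVKSApprox (dv + 1) (1 + ε) A ∧ OutputsBestBin dg dv A B ∧
        IsGVKSApprox dg dv (binCount dg * (1 + ε)) B) := by
  obtain ⟨d, rfl⟩ : ∃ d, dg = d + 1 := ⟨dg - 1, by omega⟩
  refine ⟨fun α A hα hA => exists_bestBin_program (by linarith) hA, fun ε hε => ?_⟩
  obtain ⟨A, hA⟩ := exists_isVKSApprox (dv + 1) hε
  obtain ⟨B, hB⟩ := exists_bestBin_program (d := d) (by linarith) hA
  exact ⟨A, B, hA, hB⟩
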